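/- **Setting.** Fix $\alpha\in(0,2)$, $\lambda_1^0\in(0,1)$ and matrices $\beta_1^0,\beta_2^0\in\mathbb R^{p\times q}$. For each sample size $T$ put $T_1^0=\lfloor T\lambda_1^0\rfloor$ and let $$y_t=x_t'\beta^0_1+u_t\quad(1\le t\le T_1^0),\qquad y_t=x_t'\beta^0_2+u_t\quad(T_1^0<t\le T),$$ with random $x_t\in\mathbb R^p$ (which may depend on $T$) and $u_t\in\mathbb R^q$. Write $|\cdot|$ for the Euclidean norm and $\|\cdot\|$ for the operator norm. *Estimators.* Let $\psi:\mathbb R^q\to\mathbb R$ be strictly convex, $\varphi:(\mathbb R^{p\times q})^2\to\mathbb R$ convex, both with global minimum at $0$, let $\gamma_T\ge 0$, and let $\varepsilon>0$ satisfy $\varepsilon<\lambda^0_1<1-\varepsilon$. A candidate change point is an integer $\tau$ with $\tau\ge\varepsilon T$ and $T-\tau\ge\varepsilon T$. For every candidate $\tau$ let $(\hat\beta_1(\tau),\hat\beta_2(\tau))$ be a minimizer of $$\sum_{t=1}^{\tau}\psi(x_t'\beta_1-y_t)+\sum_{t=\tau+1}^{T}\psi(x_t'\beta_2-y_t)+\gamma_T\,\varphi(\beta_1,\beta_2),$$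 and let $\hat u_t=y_t-x_t'\hat\beta_1(\tau)$ for $t\le\tau$, $\hat u_t=y_t-x_t'\hat\beta_2(\tau)$ for $t>\tau$, $U_1=(\hat u_t)_{1\le t\le\tau}$, $U_2=(\hat u_t)_{\tau<t\le T}$. For samples $V=(v_1,\dots,v_n)$, $W=(w_1,\dots,w_m)$ let $$d_\alpha(V,W)=\frac{mn}{m+n}\Big(\frac{2}{mn}\sum_{i,j}|v_i-w_j|^\alpha-\binom n2^{-1}\sum_{i<k}|v_i-v_k|^\alpha-\binom m2^{-1}\sum_{j<k}|w_j-w_k|^\alpha\Big).$$ For large $T$, let $\hat T_1$ be a (measurable) candidate change point that minimizes $\tau\mapsto\frac{n_1+n_2}{2T}\,d_\alpha(U_1,U_2)$ over all candidates, where $n_1=\tau$, $n_2=T-\tau$. *Assumptions.* - (Change.) There is no matrix $b\in\mathbb R^{p\times q}$ with $X_1'b=X_1'\beta^0_1$ a.s. and $X_2'b=X_2'\beta_2^0$ a.s., where $X_1,X_2$ are as in (A2). (If neither $X_1$ nor $X_2$ is concentrated on a proper subspace of $\mathbb R^p$, this says $\beta_1^0\ne\beta_2^0$.) - (A1) $T_1^0=\lfloor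 T\lambda_1^0\rfloor$ with $0<\lambda_1^0<1$. - (A2) $x_t\sim X_1$ for $1\le t\le T_1^0$ and $x_t\sim X_2$ for $T_1^0<t\le T$, and $E|x_t|^{2\alpha}<\infty$. - (A3) The $u_t$ are i.i.d., $u_t$ is independent of $x_s$ for all $t,s$, and $E|u_t|^{2\alpha}<\infty$. - (A4) For every (possibly data-dependent, measurable) sequence $\tau=\tau_T$ of candidate change points for which $\tau_T/T$ converges in probability to a constant, $\hat\beta_1(\tau_T)$ and $\hat\beta_2(\tau_T)$ converge in probability, in $\|\cdot\|$, to constant matrices. If moreover $\tau_T\le T_1^0$ for all large $T$, then $\hat\beta_1(\tau_T)\to\beta_1^0$ in probability; if $\tau_T\ge T_1^0$ for all large $T$, then $\hat\beta_2(\tau_T)\to\beta_2^0$ in probability. - (A5) For all $c_1,c_2\in\mathbb R^{p\times q}$ and $k\in\{1,2\}$, let $Y_{i,j}=|u_i-u_j+x_i'c_1-x_j'c_2|^\alpha$ with time points taken in the $k$-th regime. Then $\mathrm{Cov}(Y_{i_1,i_2},Y_{i_3,i_4})\to0$ as $\min_{l\ne m}|i_l-i_m|\to\infty$, and $E[Y_{i_1,i_2}]\to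 E|U-\tilde U+X_k'c_1-\tilde X_k'c_2|^\alpha$ as $|i_1-i_2|\to\infty$, uniformly in $T$. Here $U,\tilde U,X_k,\tilde X_k$ are independent, $U,\tilde U$ are distributed as $u_t$, and $\tilde X_k$ is distributed as $X_k$. **Proposition 1.** Under these assumptions, if $\hat T_1/T$ converges in probability, as $T\to\infty$, to a constant $\hat\lambda_1\in(0,1)$, then $\hat\lambda_1=\lambda_1^0$. -/

import Mathlib

open MeasureTheory ProbabilityTheory Filter Topology
open scoped Matrix.Norms.L2Operator

noncomputable section

namespace ChangePoint

/-- Vectors with the Euclidean norm. -/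
abbrev Vec (d : ℕ) : Type := EuclideanSpace ℝ (Fin d)

/-- Coefficient matrices; the norm in force is the operator norm for the Euclidean norms. -/
abbrev Coef (p q : ℕ) : Type := Matrix (Fin p) (Fin q) ℝ

/-- The product `x' b`. -/
def fit {p q : ℕ} (x : Vec p) (b : Coef p q) : Vec q :=
  WithLp.toLp 2 (Matrix.vecMul x.ofLp b)

/-! ### Empirical energy distance -/

/-- Mean of `|r_i - r_j|^α` over `i ∈ I`, `j ∈ J`. -/
def meanCross {d : ℕ} (α : ℝ) (r : ℕ → Vec d) (I J : Finset ℕ) : ℝ :=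
  ((I.card : ℝ) * (J.card : ℝ))⁻¹ * ∑ i ∈ I, ∑ j ∈ J, ‖r i - r j‖ ^ α

/-- Mean of `|r_i - r_k|^α` over the pairs `i < k` in `I`. -/
def meanWithin {d : ℕ} (α : ℝ) (r : ℕ → Vec d) (I : Finset ℕ) : ℝ :=
  (I.card.choose 2 : ℝ)⁻¹ * ∑ i ∈ I, ∑ k ∈ I with i < k, ‖r i - r k‖ ^ α

/-- The two-sample distance `d_α` of the samples `(r_t)_{t ∈ I}` and `(r_t)_{t ∈ J}`. -/
def energyDist {d : ℕ} (α : ℝ) (r : ℕ → Vec d) (I J : Finset ℕ) : ℝ :=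
  ((I.card : ℝ) * (J.card : ℝ) / ((I.card : ℝ) + (J.card : ℝ))) *
    (2 * meanCross α r I J - meanWithin α r I - meanWithin α r J)

/-! ### The regression model with one change point -/

/-- For a candidate change point `τ` and sample size `T`, segment `0` is `{1, …, τ}` and
segment `1` is `{τ + 1, …, T}`. -/
def segment (T τ : ℕ) (j : Fin 2) : Finset ℕ :=
  if j = 0 then Finset.Icc 1 τ else Finset.Icc (τ + 1) T

/-- The segment of `τ` that contains time `t`. -/
def segIndex (τ t : ℕ) : Fin 2 := if t ≤ τ then 0 else 1

/-- The candidate change points: both segments have length at least `ε T`. -/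
def admissible (ε : ℝ) (T : ℕ) : Set ℕ :=
  {τ | ε * T ≤ (τ : ℝ) ∧ ε * T ≤ (T : ℝ) - (τ : ℝ)}

/-- The data of the model. The location of the true change point moves with the sample size `T`,
so the regressors form an array `x T t`, `1 ≤ t ≤ T`. -/
structure Model (Ω : Type*) (p q : ℕ) where
  /-- disturbances `u_t` -/
  u : ℕ → Ω → Vec q
  /-- regressors `x_t` at sample size `T` -/
  x : ℕ → ℕ → Ω → Vec p
  /-- true change point fraction -/
  lam0 : ℝ
  /-- true coefficients of the two regimes -/
  beta0 : Fin 2 → Coef p q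
  /-- the law of a disturbance -/
  lawU : Measure (Vec q)
  /-- the laws of the regressors in the two regimes -/
  lawX : Fin 2 → Measure (Vec p)

namespace Model

variable {Ω : Type*} {p q : ℕ} (M : Model Ω p q)

/-- The true change point `[T λ⁰]`. -/
def T0 (T : ℕ) : ℕ := ⌊(T : ℝ) * M.lam0⌋₊

/-- The observed response `y_t = x_t' β⁰ + u_t`. -/
def y (T t : ℕ) (ω : Ω) : Vec q :=
  fit (M.x T t ω) (M.beta0 (segIndex (M.T0 T) t)) + M.u t ω

/-- The penalized empirical risk of the coefficients `b` for the candidate change point `τ`. -/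
def risk (ψ : Vec q → ℝ) (φ : (Fin 2 → Coef p q) → ℝ) (γ : ℕ → ℝ) (T τ : ℕ) (ω : Ω)
    (b : Fin 2 → Coef p q) : ℝ :=
  (∑ j : Fin 2, ∑ t ∈ segment T τ j, ψ (fit (M.x T t ω) (b j) - M.y T t ω)) + γ T * φ b

/-- The residuals when the coefficients `b` are used on the segments of `τ`. -/
def residual (T τ : ℕ) (ω : Ω) (b : Fin 2 → Coef p q) (t : ℕ) : Vec q :=
  M.y T t ω - fit (M.x T t ω) (b (segIndex τ t))

/-- The goodness-of-fit statistic at the candidate change point `τ`, with the estimators `bhat`. -/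
def objective (α : ℝ) (bhat : ℕ → ℕ → Ω → Fin 2 → Coef p q) (T : ℕ) (ω : Ω) (τ : ℕ) : ℝ :=
  ((((segment T τ 0).card : ℝ) + ((segment T τ 1).card : ℝ)) / (2 * (T : ℝ))) *
    energyDist α (M.residual T τ ω (bhat T τ ω)) (segment T τ 0) (segment T τ 1)

/-- `bhat T τ` is a regularized estimator: it minimizes the penalized risk for every candidate
change point `τ`. -/
def IsRegularizedEstimator (ε : ℝ) (ψ : Vec q → ℝ) (φ : (Fin 2 → Coef p q) → ℝ) (γ : ℕ → ℝ)
    (bhat : ℕ → ℕ → Ω → Fin 2 → Coef p q) : Prop :=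
  ∀ T, ∀ τ ∈ admissible ε T, ∀ ω, IsMinOn (M.risk ψ φ γ T τ ω) Set.univ (bhat T τ ω)

/-- `That T` is a candidate change point that minimizes the goodness-of-fit statistic (candidates
exist only for large `T`). -/
def IsEnergyMinimizer (α ε : ℝ) (bhat : ℕ → ℕ → Ω → Fin 2 → Coef p q) (That : ℕ → Ω → ℕ) : Prop :=
  ∀ᶠ T in atTop, ∀ ω, That T ω ∈ admissible ε T ∧
    IsMinOn (M.objective α bhat T ω) (admissible ε T) (That T ω)

/-- No single coefficient matrix gives the regression functions of both regimes. In particular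
`β⁰₁ ≠ β⁰₂`, and this is equivalent to `β⁰₁ ≠ β⁰₂` if neither `X₁` nor `X₂` is concentrated on a
proper subspace. -/
def StructuralChange : Prop :=
  ¬ ∃ b : Coef p q, ∀ j, ∀ᵐ ξ ∂(M.lawX j), fit ξ b = fit ξ (M.beta0 j)

variable [MeasurableSpace Ω] (P : Measure Ω)

/-- The regressors are identically distributed within regimes and have a moment of order `2α`. -/
structure RegressorAssumption (α : ℝ) : Prop where
  measurable : ∀ T t, Measurable (M.x T t)
  law : ∀ T j, ∀ t ∈ segment T (M.T0 T) j, P.map (M.x T t) = M.lawX j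
  moment : ∀ T, ∀ t ∈ Finset.Icc 1 T, Integrable (fun ω => ‖M.x T t ω‖ ^ (2 * α)) P

/-- The disturbances are i.i.d., independent of the regressors, and have a moment of
order `2α`. -/
structure DisturbanceAssumption (α : ℝ) : Prop where
  measurable : ∀ t, Measurable (M.u t)
  indep : iIndepFun M.u P
  law : ∀ t, P.map (M.u t) = M.lawU
  indep_regressor : ∀ T t, ∀ s ∈ Finset.Icc 1 T, IndepFun (M.u t) (M.x T s) P
  moment : ∀ t, Integrable (fun ω => ‖M.u t ω‖ ^ (2 * α)) P

/-- A (possibly data-dependent) sequence of candidate change points whose fraction converges in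
probability. -/
structure IsChangePointSequence (ε : ℝ) (τ : ℕ → Ω → ℕ) : Prop where
  measurable : ∀ T, Measurable (τ T)
  admissible : ∀ᶠ T in atTop, ∀ ω, τ T ω ∈ admissible ε T
  fraction : ∃ l : ℝ, TendstoInMeasure P (fun T ω => (τ T ω : ℝ) / (T : ℝ)) atTop (fun _ => l)

/-- For any change points the estimators converge in probability to constants, and an estimator
computed from a segment inside a true regime is consistent for the coefficient of that regime. -/
structure EstimatorAssumption (ε : ℝ) (bhat : ℕ → ℕ → Ω → Fin 2 → Coef p q) : Prop where
  limit : ∀ τ, IsChangePointSequence P ε τ → ∀ j, ∃ bc : Coef p q,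
    TendstoInMeasure P (fun T ω => bhat T (τ T ω) ω j) atTop (fun _ => bc)
  consistent_left : ∀ τ, IsChangePointSequence P ε τ → (∀ᶠ T in atTop, ∀ ω, τ T ω ≤ M.T0 T) →
    TendstoInMeasure P (fun T ω => bhat T (τ T ω) ω 0) atTop (fun _ => M.beta0 0)
  consistent_right : ∀ τ, IsChangePointSequence P ε τ → (∀ᶠ T in atTop, ∀ ω, M.T0 T ≤ τ T ω) →
    TendstoInMeasure P (fun T ω => bhat T (τ T ω) ω 1) atTop (fun _ => M.beta0 1)

/-- `Y_{i,j} = |u_i - u_j + x_i' c₁ - x_j' c₂|^α`. -/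
def Y (α : ℝ) (T : ℕ) (c₁ c₂ : Coef p q) (i j : ℕ) (ω : Ω) : ℝ :=
  ‖M.u i ω - M.u j ω + fit (M.x T i ω) c₁ - fit (M.x T j ω) c₂‖ ^ α

/-- `E|U - U~ + X' c₁ - X~' c₂|^α` with `U`, `U~`, `X`, `X~` independent, the first two distributed
as a disturbance and the last two as a regressor of regime `k`. -/
def limitY (α : ℝ) (k : Fin 2) (c₁ c₂ : Coef p q) : ℝ :=
  ∫ z : (Vec q × Vec q) × (Vec p × Vec p), ‖z.1.1 - z.1.2 + fit z.2.1 c₁ - fit z.2.2 c₂‖ ^ α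
    ∂((M.lawU.prod M.lawU).prod ((M.lawX k).prod (M.lawX k)))

/-- Asymptotic independence within each regime, as the time points move apart. -/
structure AsymptoticIndependence (α : ℝ) : Prop where
  cov : ∀ (k : Fin 2) (c₁ c₂ : Coef p q), ∀ η > 0, ∃ N : ℕ, ∀ T : ℕ, ∀ i : Fin 4 → ℕ,
    (∀ l, i l ∈ segment T (M.T0 T) k) →
    (∀ l m, l ≠ m → (N : ℤ) ≤ |(i l : ℤ) - (i m : ℤ)|) →
    |covariance (M.Y α T c₁ c₂ (i 0) (i 1)) (M.Y α T c₁ c₂ (i 2) (i 3)) P| < η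
  mean : ∀ (k : Fin 2) (c₁ c₂ : Coef p q), ∀ η > 0, ∃ N : ℕ, ∀ T : ℕ,
    ∀ i ∈ segment T (M.T0 T) k, ∀ j ∈ segment T (M.T0 T) k, (N : ℤ) ≤ |(i : ℤ) - (j : ℤ)| →
    |(∫ ω, M.Y α T c₁ c₂ i j ω ∂P) - M.limitY α k c₁ c₂| < η

end Model

end ChangePoint

end

/-! For `0 < α < 2` the kernel `‖x - y‖ ^ α` is the squared distance of a map `K` into a Hilbert
space, and `ρ ↦ ∫ K dρ` is injective on probability measures that integrate `K`
(`exists_energy_embedding`). The energy distance without its prefactor is therefore, up to a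
lower-order diagonal term, twice the squared distance between the averages of the two embedded
samples (`energy_le`, `le_energy`).

At the true change point both estimators are consistent, both residual samples look like
disturbances, and the objective divided by `T` tends to `0`. The minimizer does no worse, so its two
segments also have equal embedded averages in the limit (`limit_averages_eq`). Suppose its limit
fraction lay strictly inside one regime. The segment within that regime yields the law of `U`; the
other segment yields a proper mixture of the laws of `U + X_k'(β⁰_k - c)`, with `c` the limit of its
estimator. Injectivity gives `law U = law U * η`, where `η` mixes the laws of `X_k'(β⁰_k - c)`.
Dividing characteristic functions near `0` forces `η = δ₀` (`ae_eq_zero_of_conv_eq`). Both weights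
are positive, so `c` fits both regimes, against the assumed change.

The limits come from a mean-square law of large numbers in the Hilbert space. Correlations of
embedded residuals are read off from `E|r_i - r_j|^α` by polarization (`integral_inner_sub_mean`).
That law concerns fixed coefficients and deterministic index sets; Cauchy–Schwarz carries it over to
estimated coefficients and random segments (`tendsto_average_of_perturbation`). The resulting
identity is deterministic, so a single path of a suitable subsequence suffices to establish it. -/

noncomputable section

namespace ChangePoint

/-! ### A Hilbert space embedding for the energy distance -/

section Embedding

variable {E : Type*} [NormedAddCommGroup E] [InnerProductSpace ℝ E]

/-- The centred character `s ↦ exp(i⟨x, s⟩) - 1`. -/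
def centredChar (x s : E) : ℂ := Complex.exp (((inner ℝ x s : ℝ) : ℂ) * Complex.I) - 1

lemma continuous_uncurry_centredChar : Continuous (Function.uncurry (centredChar (E := E))) := by
  unfold centredChar Function.uncurry
  fun_prop

lemma continuous_centredChar (x : E) : Continuous (centredChar x) := by
  unfold centredChar
  fun_prop

lemma norm_centredChar_le_two (x s : E) : ‖centredChar x s‖ ≤ 2 := by
  unfold centredChar
  rw [mul_comm, Complex.norm_exp_I_mul_ofReal_sub_one, norm_mul]
  have := Real.abs_sin_le_one (inner ℝ x s / 2)
  simp only [Real.norm_eq_abs, Nat.abs_ofNat]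
  linarith

lemma norm_centredChar_le (x s : E) : ‖centredChar x s‖ ≤ ‖x‖ * ‖s‖ := by
  unfold centredChar
  rw [mul_comm]
  exact Real.norm_exp_I_mul_ofReal_sub_one_le.trans (norm_inner_le_norm x s)

/-- A unimodular factor splits off the difference, so distances between embedded points are
translation invariant. -/
lemma norm_centredChar_sub (x y s : E) :
    ‖centredChar x s - centredChar y s‖ = ‖centredChar (x - y) s‖ := by
  have h : centredChar x s - centredChar y s =
      Complex.exp (((inner ℝ y s : ℝ) : ℂ) * Complex.I) * centredChar (x - y) s := by
    unfold centredChar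
    rw [mul_sub, ← Complex.exp_add, inner_sub_left]
    push_cast
    ring_nf
  rw [h, norm_mul, Complex.norm_exp_ofReal_mul_I, one_mul]

lemma centredChar_smul (c : ℝ) (x s : E) : centredChar (c • x) s = centredChar x (c • s) := by
  unfold centredChar
  rw [real_inner_smul_left, real_inner_smul_right]

variable (E) in
/-- The density of the spectral measure of the kernel `‖x - y‖ ^ α`. -/
def spectralDensity (α : ℝ) (s : E) : ℝ := ‖s‖ ^ (-(Module.finrank ℝ E + α))

lemma spectralDensity_nonneg (α : ℝ) (s : E) : 0 ≤ spectralDensity E α s :=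
  Real.rpow_nonneg (norm_nonneg _) _

variable [MeasurableSpace E] [BorelSpace E]

lemma measurable_spectralDensity (α : ℝ) : Measurable (spectralDensity E α) := by
  unfold spectralDensity
  fun_prop

variable [FiniteDimensional ℝ E]

/-- In polar coordinates the integrand is `r ^ (1 - α)` near `0` and `r ^ (-1 - α)` at infinity;
these need `α < 2` and `α > 0` respectively. -/
lemma integrable_min_mul_spectralDensity [Nontrivial E] {α : ℝ} (hα : α ∈ Set.Ioo (0 : ℝ) 2) :
    Integrable (fun s : E => min 1 (‖s‖ ^ 2) * spectralDensity E α s) := by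
  have hd : 1 ≤ Module.finrank ℝ E := Module.finrank_pos
  refine (integrable_fun_norm_addHaar (E := E) volume
    (f := fun r : ℝ => min 1 (r ^ 2) * r ^ (-(Module.finrank ℝ E + α)))).2 ?_
  have key : ∀ r : ℝ, 0 < r → r ^ (Module.finrank ℝ E - 1) *
      r ^ (-(Module.finrank ℝ E + α)) = r ^ (-1 - α) := by
    intro r hr
    rw [← Real.rpow_natCast, ← Real.rpow_add hr, Nat.cast_sub hd]
    congr 1
    push_cast
    ring
  rw [← Set.Ioc_union_Ioi_eq_Ioi (zero_le_one (α := ℝ))]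
  refine IntegrableOn.union ?_ ?_
  · have h : IntegrableOn (fun r : ℝ => r ^ (1 - α)) (Set.Ioc 0 1) := by
      rw [← intervalIntegrable_iff_integrableOn_Ioc_of_le zero_le_one]
      exact intervalIntegral.intervalIntegrable_rpow' (by linarith [hα.2])
    refine h.congr_fun (fun r hr => ?_) measurableSet_Ioc
    have h1 : min 1 (r ^ 2) = r ^ 2 := min_eq_right (by nlinarith [hr.1, hr.2])
    simp only [h1, smul_eq_mul]
    rw [mul_left_comm, key r hr.1, ← Real.rpow_natCast, ← Real.rpow_add hr.1]
    congr 1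
    push_cast
    ring
  · have h : IntegrableOn (fun r : ℝ => r ^ (-1 - α)) (Set.Ioi 1) :=
      integrableOn_Ioi_rpow_of_lt (by linarith [hα.1]) one_pos
    refine h.congr_fun (fun r hr => ?_) measurableSet_Ioi
    have hr' : 1 < r := hr
    have h1 : min 1 (r ^ 2) = 1 := min_eq_left (by nlinarith)
    simp only [h1, smul_eq_mul, one_mul]
    rw [key r (by linarith)]

lemma integrable_sq_norm_centredChar_mul [Nontrivial E] {α : ℝ} (hα : α ∈ Set.Ioo (0 : ℝ) 2)
    (x : E) : Integrable (fun s : E => ‖centredChar x s‖ ^ 2 * spectralDensity E α s) := by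
  -- The `4` serves for large `s`, where the character is merely bounded, and `‖x‖ ^ 2` serves near
  -- `0`, where it is Lipschitz.
  refine ((integrable_min_mul_spectralDensity hα).const_mul (4 + ‖x‖ ^ 2)).mono' ?_ ?_
  · exact (((continuous_centredChar x).norm.pow 2).measurable.mul
      (measurable_spectralDensity α)).aestronglyMeasurable
  · refine Eventually.of_forall fun s => ?_
    have h0 := spectralDensity_nonneg α s
    rw [Real.norm_of_nonneg (by positivity), ← mul_assoc]
    refine mul_le_mul_of_nonneg_right ?_ h0
    have h1 := norm_centredChar_le_two x s
    have h2 := norm_centredChar_le x s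
    have h3 : ‖centredChar x s‖ ^ 2 ≤ 4 := by nlinarith [norm_nonneg (centredChar x s)]
    have h4 : ‖centredChar x s‖ ^ 2 ≤ ‖x‖ ^ 2 * ‖s‖ ^ 2 := by
      rw [← mul_pow]; exact pow_le_pow_left₀ (norm_nonneg _) h2 2
    rcases min_cases 1 (‖s‖ ^ 2) with h | h <;> rw [h.1] <;> nlinarith [sq_nonneg ‖x‖, sq_nonneg ‖s‖]

/-- The squared distance of the embedded points `x` and `0`, up to normalization. -/
def spectralIntegral (α : ℝ) (x : E) : ℝ := ∫ s, ‖centredChar x s‖ ^ 2 * spectralDensity E α s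

/-- Substitute `c • s` for `s`: the density contributes `c ^ (dim + α)` and Lebesgue measure takes
back `c ^ dim`. -/
lemma spectralIntegral_smul (α : ℝ) {c : ℝ} (hc : 0 < c) (x : E) :
    spectralIntegral α (c • x) = c ^ α * spectralIntegral α x := by
  have h : ∀ s : E, ‖centredChar (c • x) s‖ ^ 2 * spectralDensity E α s =
      c ^ (Module.finrank ℝ E + α) *
        (‖centredChar x (c • s)‖ ^ 2 * spectralDensity E α (c • s)) := by
    intro s
    rw [centredChar_smul, spectralDensity, spectralDensity, norm_smul, Real.norm_of_nonneg hc.le,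
      Real.mul_rpow hc.le (norm_nonneg _), Real.rpow_neg hc.le]
    have : c ^ (Module.finrank ℝ E + α) ≠ 0 := (Real.rpow_pos_of_pos hc _).ne'
    field_simp
  unfold spectralIntegral
  simp_rw [h]
  rw [integral_const_mul, Measure.integral_comp_smul volume
    (fun s : E => ‖centredChar x s‖ ^ 2 * spectralDensity E α s), smul_eq_mul, ← mul_assoc,
    abs_of_pos (by positivity)]
  congr 1
  rw [Real.rpow_add hc, Real.rpow_natCast]
  have : c ^ Module.finrank ℝ E ≠ 0 := by positivity
  field_simp

/-- The reflection exchanging `x` and `y` preserves both Lebesgue measure and the radial density. -/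
lemma spectralIntegral_congr_norm (α : ℝ) {x y : E} (h : ‖x‖ = ‖y‖) :
    spectralIntegral α x = spectralIntegral α y := by
  set R := (ℝ ∙ (x - y))ᗮ.reflection with hR
  have hxy : R x = y := Submodule.reflection_sub h
  unfold spectralIntegral
  rw [← (R.measurePreserving).integral_comp R.toHomeomorph.measurableEmbedding
    (fun s => ‖centredChar y s‖ ^ 2 * spectralDensity E α s)]
  refine integral_congr_ae (Eventually.of_forall fun s => ?_)
  have h1 : centredChar y (R s) = centredChar x s := by
    unfold centredChar
    rw [← hxy, R.inner_map_map]
  simp only [h1, spectralDensity, R.norm_map]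

/-- Rotation invariance and homogeneity reduce everything to one unit vector `e`, whose integral is
the constant. -/
lemma exists_spectralIntegral_eq [Nontrivial E] {α : ℝ} (hα : α ∈ Set.Ioo (0 : ℝ) 2) :
    ∃ C > 0, ∀ x : E, spectralIntegral α x = C * ‖x‖ ^ α := by
  obtain ⟨e, he⟩ := exists_norm_eq E (zero_le_one (α := ℝ))
  refine ⟨spectralIntegral α e, ?_, fun x => ?_⟩
  · have hnn : ∀ s, 0 ≤ ‖centredChar e s‖ ^ 2 * spectralDensity E α s := fun s =>
      mul_nonneg (sq_nonneg _) (spectralDensity_nonneg α s)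
    refine lt_of_le_of_ne (integral_nonneg hnn) fun h0 => ?_
    have h1 := (integral_eq_zero_iff_of_nonneg hnn (integrable_sq_norm_centredChar_mul hα e)).1
      h0.symm
    have h2 : centredChar e =ᵐ[volume] fun _ => 0 := by
      filter_upwards [h1, Measure.ae_ne volume (0 : E)] with s hs hs0
      have h3 : 0 < spectralDensity E α s := Real.rpow_pos_of_pos (norm_pos_iff.2 hs0) _
      rcases mul_eq_zero.1 hs with h | h
      · simpa using h
      · exact absurd h h3.ne'
    -- By continuity the character would equal `1` everywhere, but at `s = π • e` it is `-1`.
    have h3 := congrFun ((Continuous.ae_eq_iff_eq volume (continuous_centredChar e)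
      continuous_const).1 h2) (Real.pi • e)
    rw [centredChar, real_inner_smul_right, real_inner_self_eq_norm_sq, he, one_pow, mul_one,
      Complex.exp_pi_mul_I] at h3
    norm_num at h3
  · rcases eq_or_ne x 0 with rfl | hx
    · simp [spectralIntegral, centredChar, Real.zero_rpow hα.1.ne']
    · have h1 : ‖x‖ = ‖‖x‖ • e‖ := by rw [norm_smul, he, norm_norm, mul_one]
      rw [spectralIntegral_congr_norm α h1, spectralIntegral_smul α (norm_pos_iff.2 hx), mul_comm]

variable (E) in
/-- The spectral measure of the kernel `‖x - y‖ ^ α`. -/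
def spectralMeasure (α : ℝ) : Measure E :=
  volume.withDensity fun s => ENNReal.ofReal (spectralDensity E α s)

instance (α : ℝ) : SigmaFinite (spectralMeasure E α) := SigmaFinite.withDensity_ofReal _

lemma volume_absolutelyContinuous_spectralMeasure [Nontrivial E] (α : ℝ) :
    (volume : Measure E) ≪ spectralMeasure E α := by
  refine withDensity_absolutelyContinuous' (measurable_spectralDensity α).ennreal_ofReal.aemeasurable ?_
  filter_upwards [Measure.ae_ne volume (0 : E)] with s hs
  have h : 0 < spectralDensity E α s := Real.rpow_pos_of_pos (norm_pos_iff.2 hs) _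
  simpa using h

lemma memLp_centredChar [Nontrivial E] {α : ℝ} (hα : α ∈ Set.Ioo (0 : ℝ) 2) (x : E) :
    MemLp (centredChar x) 2 (spectralMeasure E α) := by
  rw [memLp_two_iff_integrable_sq_norm (continuous_centredChar x).aestronglyMeasurable,
    spectralMeasure, integrable_withDensity_iff (measurable_spectralDensity α).ennreal_ofReal
      (Eventually.of_forall fun _ => ENNReal.ofReal_lt_top)]
  simpa only [ENNReal.toReal_ofReal (spectralDensity_nonneg α _)] using
    integrable_sq_norm_centredChar_mul hα x

lemma integral_sq_norm_spectralMeasure (α : ℝ) (x : E) :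
    ∫ s, ‖centredChar x s‖ ^ 2 ∂(spectralMeasure E α) = spectralIntegral α x := by
  rw [spectralMeasure, integral_withDensity_eq_integral_toReal_smul
    (measurable_spectralDensity α).ennreal_ofReal
    (Eventually.of_forall fun _ => ENNReal.ofReal_lt_top)]
  simp only [ENNReal.toReal_ofReal (spectralDensity_nonneg α _), smul_eq_mul, spectralIntegral,
    mul_comm]

/-- The embedding of points into `L²` of the spectral measure. -/
def charLp [Nontrivial E] {α : ℝ} (hα : α ∈ Set.Ioo (0 : ℝ) 2) (x : E) :
    Lp ℂ 2 (spectralMeasure E α) := (memLp_centredChar hα x).toLp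

lemma sq_norm_toLp {S : Type*} [MeasurableSpace S] {μ : Measure S} {f : S → ℂ} (hf : MemLp f 2 μ) :
    ‖hf.toLp‖ ^ 2 = ∫ s, ‖f s‖ ^ 2 ∂μ := by
  rw [← real_inner_self_eq_norm_sq, L2.inner_def]
  refine integral_congr_ae ?_
  filter_upwards [hf.coeFn_toLp] with s hs
  rw [hs, real_inner_self_eq_norm_sq]

lemma sq_norm_charLp_sub [Nontrivial E] {α : ℝ} (hα : α ∈ Set.Ioo (0 : ℝ) 2) (x y : E) :
    ‖charLp hα x - charLp hα y‖ ^ 2 = spectralIntegral α (x - y) := by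
  rw [charLp, charLp, ← MemLp.toLp_sub, sq_norm_toLp, ← integral_sq_norm_spectralMeasure]
  simp only [Pi.sub_apply, norm_centredChar_sub]

/-- A Bochner integral in `L²` is only a class of functions. Testing it against indicators of sets
of finite measure, with Fubini for the bounded characters, identifies it with the pointwise
integral. -/
lemma integral_charLp_ae_eq [Nontrivial E] {α : ℝ} (hα : α ∈ Set.Ioo (0 : ℝ) 2)
    (ρ : Measure E) [IsProbabilityMeasure ρ] (hρ : Integrable (charLp hα) ρ) :
    (∫ x, charLp hα x ∂ρ : Lp ℂ 2 (spectralMeasure E α)) =ᵐ[spectralMeasure E α]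
      fun s => charFun ρ s - 1 := by
  have hcf : ∀ s, charFun ρ s - 1 = ∫ x, centredChar x s ∂ρ := by
    intro s
    have hinteg : Integrable (fun x : E => Complex.exp (((inner ℝ x s : ℝ) : ℂ) * Complex.I)) ρ := by
      refine Integrable.of_bound (C := 1) (by fun_prop) (Eventually.of_forall fun x => ?_)
      rw [Complex.norm_exp_ofReal_mul_I]
    unfold centredChar
    rw [charFun_apply, integral_sub hinteg (integrable_const _)]
    simp
  refine ae_eq_of_forall_setIntegral_eq_of_sigmaFinite (fun A hA hAfin => ?_)
    (fun A hA hAfin => ?_) fun A hA hAfin => ?_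
  · exact integrableOn_Lp_of_measure_ne_top _ (by norm_num) hAfin.ne
  · refine IntegrableOn.of_bound hAfin
      ((continuous_charFun.sub continuous_const).aestronglyMeasurable) 2
      (Eventually.of_forall fun s => ?_)
    refine (norm_sub_le _ _).trans ?_
    have := norm_charFun_le_one (μ := ρ) (t := s)
    simp only [norm_one]
    linarith
  · have : IsFiniteMeasure ((spectralMeasure E α).restrict A) := ⟨by simpa using hAfin⟩
    rw [← L2.inner_indicatorConstLp_one hA hAfin.ne, ← integral_inner hρ]
    simp_rw [L2.inner_indicatorConstLp_one hA hAfin.ne, hcf]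
    rw [← integral_integral_swap (f := centredChar (E := E))]
    · refine integral_congr_ae (Eventually.of_forall fun x => ?_)
      exact integral_congr_ae (ae_restrict_of_ae (memLp_centredChar hα x).coeFn_toLp)
    · exact Integrable.of_bound (C := 2) continuous_uncurry_centredChar.aestronglyMeasurable
        (Eventually.of_forall fun z => norm_centredChar_le_two z.1 z.2)

/-- For `α ∈ (0, 2)` the kernel `‖x - y‖ ^ α` is the squared distance of a Hilbert space embedding
that separates probability measures. -/
theorem exists_energy_embedding [Nontrivial E] {α : ℝ} (hα : α ∈ Set.Ioo (0 : ℝ) 2) :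
    ∃ K : E → Lp ℂ 2 (spectralMeasure E α), K 0 = 0 ∧
      (∀ x y, ‖K x - K y‖ ^ 2 = ‖x - y‖ ^ α) ∧
      ∀ ρ ρ' : Measure E, IsProbabilityMeasure ρ → IsProbabilityMeasure ρ' →
        Integrable K ρ → Integrable K ρ' → ∫ x, K x ∂ρ = ∫ x, K x ∂ρ' → ρ = ρ' := by
  obtain ⟨C, hC, hCx⟩ := exists_spectralIntegral_eq (E := E) hα
  have hC' : (√C)⁻¹ ≠ 0 := by positivity
  refine ⟨fun x => (√C)⁻¹ • charLp hα x, ?_, fun x y => ?_, ?_⟩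
  · have h := sq_norm_toLp (memLp_centredChar hα (0 : E))
    have h0 : centredChar (0 : E) = 0 := by ext; simp [centredChar]
    have : ‖charLp hα (0 : E)‖ ^ 2 = 0 := by
      rw [charLp, h, h0]; simp
    have h1 : charLp hα (0 : E) = 0 := by simpa using this
    simp only [h1, smul_zero]
  · rw [← smul_sub, norm_smul, mul_pow, sq_norm_charLp_sub, hCx, norm_inv, Real.norm_of_nonneg
      (Real.sqrt_nonneg _), inv_pow, Real.sq_sqrt hC.le]
    field_simp
  · intro ρ ρ' _ _ hρ hρ' h
    replace hρ : Integrable (charLp hα) ρ := (integrable_smul_iff hC' _).1 hρ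
    replace hρ' : Integrable (charLp hα) ρ' := (integrable_smul_iff hC' _).1 hρ'
    rw [integral_smul, integral_smul] at h
    replace h := smul_right_injective _ hC' h
    have h1 := integral_charLp_ae_eq hα ρ hρ
    have h2 := integral_charLp_ae_eq hα ρ' hρ'
    rw [h] at h1
    -- The spectral density is positive off the origin, so equality passes to Lebesgue-almost every
    -- `s`, and by continuity to every `s`.
    have h3 := (volume_absolutelyContinuous_spectralMeasure α).ae_le (h1.symm.trans h2)
    have h4 := (Continuous.ae_eq_iff_eq volume (continuous_charFun.sub continuous_const)
      (continuous_charFun.sub continuous_const)).1 h3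
    refine Measure.ext_of_charFun (funext fun s => ?_)
    simpa using congrFun h4 s

end Embedding

/-! ### Deconvolution -/

section Deconvolution

variable {E : Type*} [NormedAddCommGroup E] [InnerProductSpace ℝ E] [FiniteDimensional ℝ E]
  [MeasurableSpace E] [BorelSpace E]

/-- The real part at `s / (n + 1)` forces the cosine of `⟨z, s⟩ / (n + 1)` to be `1` almost surely.
For fixed `z` and large `n` this angle is below `1` in modulus, which excludes nonzero multiples of
`2π`. -/
lemma ae_inner_eq_zero_of_charFun_eq_one (ν : Measure E) [IsProbabilityMeasure ν]
    (h : ∀ᶠ s in 𝓝 (0 : E), charFun ν s = 1) (s : E) : ∀ᵐ z ∂ν, inner ℝ z s = 0 := by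
  have hlim : Tendsto (fun n : ℕ => ((n : ℝ) + 1)⁻¹ • s) atTop (𝓝 0) := by
    have : Tendsto (fun n : ℕ => ((n : ℝ) + 1)⁻¹) atTop (𝓝 0) := by
      simpa using tendsto_one_div_add_atTop_nhds_zero_nat (𝕜 := ℝ)
    simpa using this.smul_const s
  obtain ⟨N, hN⟩ := eventually_atTop.1 (hlim.eventually h)
  have hcos : ∀ n ≥ N, ∀ᵐ z ∂ν, Real.cos (inner ℝ z s / ((n : ℝ) + 1)) = 1 := by
    intro n hn
    have hinteg : Integrable (fun z : E =>
        Complex.exp (((inner ℝ z (((n : ℝ) + 1)⁻¹ • s) : ℝ) : ℂ) * Complex.I)) ν := by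
      refine Integrable.of_bound (C := 1) (by fun_prop) (Eventually.of_forall fun x => ?_)
      rw [Complex.norm_exp_ofReal_mul_I]
    have h1 := congrArg Complex.re (hN n hn)
    rw [charFun_apply] at h1
    have h2 : (∫ z, Complex.exp (((inner ℝ z (((n : ℝ) + 1)⁻¹ • s) : ℝ) : ℂ) * Complex.I) ∂ν).re
        = ∫ z, Real.cos (inner ℝ z s / ((n : ℝ) + 1)) ∂ν := by
      refine (integral_re hinteg).symm.trans (integral_congr_ae (Eventually.of_forall fun z => ?_))
      simp only [RCLike.re_eq_complex_re, Complex.exp_ofReal_mul_I_re, real_inner_smul_right]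
      rw [mul_comm, div_eq_mul_inv]
    rw [h2, Complex.one_re] at h1
    have hcint : Integrable (fun z : E => Real.cos (inner ℝ z s / ((n : ℝ) + 1))) ν :=
      Integrable.of_bound (C := 1) (by fun_prop)
        (Eventually.of_forall fun x => Real.abs_cos_le_one _)
    have h3 : ∫ z, (1 - Real.cos (inner ℝ z s / ((n : ℝ) + 1))) ∂ν = 0 := by
      rw [integral_sub (integrable_const _) hcint, h1]
      simp
    rw [integral_eq_zero_iff_of_nonneg (fun z => sub_nonneg.2 (Real.cos_le_one _))
      ((integrable_const _).sub hcint)] at h3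
    filter_upwards [h3] with z hz
    simp only [Pi.zero_apply] at hz
    linarith
  have hall : ∀ᵐ z ∂ν, ∀ n ≥ N, Real.cos (inner ℝ z s / ((n : ℝ) + 1)) = 1 :=
    ae_all_iff.2 fun n => by
      by_cases hn : n ≥ N
      · filter_upwards [hcos n hn] with z hz _ using hz
      · exact Eventually.of_forall fun z hz => absurd hz hn
  filter_upwards [hall] with z hz
  obtain ⟨n, hn⟩ := exists_nat_gt (max |inner ℝ z s| N)
  have hn1 : |inner ℝ z s| < n := (le_max_left _ _).trans_lt hn
  have hn2 : N ≤ n := by exact_mod_cast ((le_max_right _ _).trans_lt hn).le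
  have hpos : (0 : ℝ) < n + 1 := by positivity
  have hlt : |inner ℝ z s / ((n : ℝ) + 1)| < 1 := by
    rw [abs_div, abs_of_pos hpos, div_lt_one hpos]
    linarith
  have hpi := Real.pi_gt_three
  rw [abs_lt] at hlt
  have h0 := (Real.cos_eq_one_iff_of_lt_of_lt (by linarith) (by linarith)).1 (hz n hn2)
  simpa [hpos.ne'] using h0

/-- The characteristic function of `μ` may vanish somewhere, but not near `0`, where it equals `1`;
cancelling it in that neighbourhood is enough. -/
lemma ae_eq_zero_of_conv_eq (μ ν : Measure E) [IsProbabilityMeasure μ] [IsProbabilityMeasure ν]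
    (h : μ.conv ν = μ) : ∀ᵐ z ∂ν, z = 0 := by
  have hne : ∀ᶠ s in 𝓝 (0 : E), charFun μ s ≠ 0 := by
    refine continuous_charFun.continuousAt.eventually_ne ?_
    simp
  have h1 : ∀ᶠ s in 𝓝 (0 : E), charFun ν s = 1 := by
    filter_upwards [hne] with s hs
    have h2 := charFun_conv (μ := μ) (ν := ν) s
    rw [h] at h2
    exact (mul_left_cancel₀ hs (by rw [mul_one]; exact h2)).symm
  have h2 : ∀ᵐ z ∂ν, ∀ i, inner ℝ z (stdOrthonormalBasis ℝ E i) = 0 :=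
    ae_all_iff.2 fun i => ae_inner_eq_zero_of_charFun_eq_one ν h1 _
  filter_upwards [h2] with z hz
  refine (stdOrthonormalBasis ℝ E).repr.injective ?_
  ext i
  rw [OrthonormalBasis.repr_apply_apply, real_inner_comm, hz i]
  simp

end Deconvolution

/-! ### The energy distance in terms of an embedding -/

section EnergyIdentity

variable {H : Type*} [NormedAddCommGroup H] [InnerProductSpace ℝ H]

lemma sum_sum_sq_norm_sub {ι : Type*} (z : ι → H) (I J : Finset ι) :
    ∑ i ∈ I, ∑ j ∈ J, ‖z i - z j‖ ^ 2 = (J.card : ℝ) * ∑ i ∈ I, ‖z i‖ ^ 2 +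
      (I.card : ℝ) * ∑ j ∈ J, ‖z j‖ ^ 2 - 2 * inner ℝ (∑ i ∈ I, z i) (∑ j ∈ J, z j) := by
  simp_rw [norm_sub_sq_real, sum_inner, inner_sum, Finset.sum_add_distrib, Finset.sum_sub_distrib,
    Finset.sum_const, nsmul_eq_mul, Finset.mul_sum]
  rw [← Finset.mul_sum]
  ring

lemma sum_sum_lt_eq_half {f : ℕ → ℕ → ℝ} (hf : ∀ i j, f i j = f j i) (h0 : ∀ i, f i i = 0)
    (I : Finset ℕ) : ∑ i ∈ I, ∑ k ∈ I with i < k, f i k = (∑ i ∈ I, ∑ k ∈ I, f i k) / 2 := by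
  have h1 : ∑ i ∈ I, ∑ k ∈ I with k < i, f i k = ∑ i ∈ I, ∑ k ∈ I with i < k, f i k := by
    simp_rw [Finset.sum_filter]
    rw [Finset.sum_comm]
    simp_rw [hf]
  have h2 : ∀ i, ∑ k ∈ I, f i k = ∑ k ∈ I with i < k, f i k + ∑ k ∈ I with k < i, f i k := by
    intro i
    simp_rw [Finset.sum_filter, ← Finset.sum_add_distrib]
    refine Finset.sum_congr rfl fun k _ => ?_
    rcases lt_trichotomy i k with h | h | h
    · simp [h, h.not_gt]
    · simp [h, h0]
    · simp [h, h.not_gt]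
  simp_rw [h2]
  rw [Finset.sum_add_distrib, h1]
  ring

variable {d : ℕ} {α : ℝ} {K : Vec d → H}

lemma meanCross_eq (hK : ∀ x y, ‖K x - K y‖ ^ 2 = ‖x - y‖ ^ α) (r : ℕ → Vec d) {I J : Finset ℕ}
    (hI : I.Nonempty) (hJ : J.Nonempty) :
    meanCross α r I J = (I.card : ℝ)⁻¹ * ∑ i ∈ I, ‖K (r i)‖ ^ 2 +
      (J.card : ℝ)⁻¹ * ∑ j ∈ J, ‖K (r j)‖ ^ 2 -
      2 * inner ℝ ((I.card : ℝ)⁻¹ • ∑ i ∈ I, K (r i)) ((J.card : ℝ)⁻¹ • ∑ j ∈ J, K (r j)) := by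
  have hI' : (I.card : ℝ) ≠ 0 := by exact_mod_cast hI.card_pos.ne'
  have hJ' : (J.card : ℝ) ≠ 0 := by exact_mod_cast hJ.card_pos.ne'
  unfold meanCross
  simp_rw [← hK]
  rw [sum_sum_sq_norm_sub (fun i => K (r i)), real_inner_smul_left, real_inner_smul_right]
  field_simp

lemma meanWithin_nonneg (r : ℕ → Vec d) (I : Finset ℕ) : 0 ≤ meanWithin α r I := by
  unfold meanWithin
  positivity

/-- The factor `n - 1` reflects the normalization by `n (n - 1) / 2` pairs, in contrast to the `n ^
2` terms of the full double sum. -/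
lemma meanWithin_eq (hα : α ≠ 0) (hK : ∀ x y, ‖K x - K y‖ ^ 2 = ‖x - y‖ ^ α) (r : ℕ → Vec d)
    {I : Finset ℕ} (hI : 2 ≤ I.card) :
    ((I.card : ℝ) - 1) * meanWithin α r I = 2 * ∑ i ∈ I, ‖K (r i)‖ ^ 2 -
      2 * (I.card : ℝ) * ‖(I.card : ℝ)⁻¹ • ∑ i ∈ I, K (r i)‖ ^ 2 := by
  have hI2 : (2 : ℝ) ≤ I.card := by exact_mod_cast hI
  have hI1 : (I.card : ℝ) - 1 ≠ 0 := by linarith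
  have hI' : (I.card : ℝ) ≠ 0 := by linarith
  unfold meanWithin
  rw [sum_sum_lt_eq_half (fun i j => by rw [norm_sub_rev]) (fun i => by simp [hα])]
  simp_rw [← hK]
  rw [sum_sum_sq_norm_sub (fun i => K (r i)), real_inner_self_eq_norm_sq, norm_smul,
    Nat.cast_choose_two, norm_inv, Real.norm_natCast]
  field_simp
  ring

/-- Omitting the zero diagonal terms from the normalization only increases the within-sample means,
so this direction carries no error term. It is applied at the true change point. -/
lemma energy_le (hα : α ≠ 0) (hK : ∀ x y, ‖K x - K y‖ ^ 2 = ‖x - y‖ ^ α) (r : ℕ → Vec d)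
    {I J : Finset ℕ} (hI : 2 ≤ I.card) (hJ : 2 ≤ J.card) :
    2 * meanCross α r I J - meanWithin α r I - meanWithin α r J ≤
      2 * ‖(I.card : ℝ)⁻¹ • ∑ i ∈ I, K (r i) - (J.card : ℝ)⁻¹ • ∑ j ∈ J, K (r j)‖ ^ 2 := by
  have hI2 : (2 : ℝ) ≤ I.card := by exact_mod_cast hI
  have hJ2 : (2 : ℝ) ≤ J.card := by exact_mod_cast hJ
  have h1 := meanWithin_eq hα hK r hI
  have h2 := meanWithin_eq hα hK r hJ
  rw [meanCross_eq hK r (Finset.card_pos.1 (by omega)) (Finset.card_pos.1 (by omega)),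
    norm_sub_sq_real]
  have key : ∀ n W Q a : ℝ, 2 ≤ n → 0 ≤ W → (n - 1) * W = 2 * Q - 2 * n * a →
      2 * (n⁻¹ * Q) - W ≤ 2 * a := by
    intro n W Q a hn hW h
    have hn' : n ≠ 0 := by linarith
    have hQ : n⁻¹ * Q = ((n - 1) * W / 2 + n * a) / n := by rw [h]; field_simp; ring
    have : 2 * (n⁻¹ * Q) - W = 2 * a - W / n := by rw [hQ]; field_simp; ring
    rw [this]
    have : 0 ≤ W / n := div_nonneg hW (by linarith)
    linarith
  have h3 := key _ _ _ _ hI2 (meanWithin_nonneg (α := α) r I) h1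
  have h4 := key _ _ _ _ hJ2 (meanWithin_nonneg (α := α) r J) h2
  linarith

lemma le_energy (hα : α ≠ 0) (hK : ∀ x y, ‖K x - K y‖ ^ 2 = ‖x - y‖ ^ α) (r : ℕ → Vec d)
    {I J : Finset ℕ} (hI : 2 ≤ I.card) (hJ : 2 ≤ J.card) :
    2 * ‖(I.card : ℝ)⁻¹ • ∑ i ∈ I, K (r i) - (J.card : ℝ)⁻¹ • ∑ j ∈ J, K (r j)‖ ^ 2 -
      4 * ((∑ i ∈ I, ‖K (r i)‖ ^ 2) / (I.card : ℝ) ^ 2) -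
      4 * ((∑ j ∈ J, ‖K (r j)‖ ^ 2) / (J.card : ℝ) ^ 2) ≤
    2 * meanCross α r I J - meanWithin α r I - meanWithin α r J := by
  have hI2 : (2 : ℝ) ≤ I.card := by exact_mod_cast hI
  have hJ2 : (2 : ℝ) ≤ J.card := by exact_mod_cast hJ
  have h1 := meanWithin_eq hα hK r hI
  have h2 := meanWithin_eq hα hK r hJ
  rw [meanCross_eq hK r (Finset.card_pos.1 (by omega)) (Finset.card_pos.1 (by omega)),
    norm_sub_sq_real]
  -- The exact defect is `W / n ≤ 2 * Q / (n * (n - 1))`, and `n ≥ 2` gives `n * (n - 1) ≥ n ^ 2 /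
  -- 2`; hence the `4`.
  have key : ∀ n W Q a : ℝ, 2 ≤ n → 0 ≤ Q → 0 ≤ a → (n - 1) * W = 2 * Q - 2 * n * a →
      2 * a - 4 * (Q / n ^ 2) ≤ 2 * (n⁻¹ * Q) - W := by
    intro n W Q a hn hQ ha h
    have hn' : n ≠ 0 := by linarith
    have hn1 : n - 1 ≠ 0 := by linarith
    have hW : W = (2 * Q - 2 * n * a) / (n - 1) := by rw [← h]; field_simp
    have e : 2 * (n⁻¹ * Q) - W - (2 * a - 4 * (Q / n ^ 2)) =
        (2 * Q * (n - 2) / n ^ 2 + 2 * a) / (n - 1) := by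
      rw [hW]; field_simp; ring
    have : 0 ≤ (2 * Q * (n - 2) / n ^ 2 + 2 * a) / (n - 1) := by
      have := sub_nonneg.2 hn
      have : 0 ≤ n - 1 := by linarith
      positivity
    linarith
  have h3 := key _ _ _ _ hI2 (Finset.sum_nonneg fun i _ => sq_nonneg ‖K (r i)‖) (sq_nonneg _) h1
  have h4 := key _ _ _ _ hJ2 (Finset.sum_nonneg fun i _ => sq_nonneg ‖K (r i)‖) (sq_nonneg _) h2
  linarith

end EnergyIdentity

/-! ### A law of large numbers in a Hilbert space -/

section LawOfLargeNumbers

variable {Ω : Type*} [MeasurableSpace Ω] {P : Measure Ω}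
  {H : Type*} [NormedAddCommGroup H] [InnerProductSpace ℝ H]

lemma integrable_inner_of_memLp_two {Z Z' : Ω → H} (hZ : MemLp Z 2 P) (hZ' : MemLp Z' 2 P) :
    Integrable (fun ω => inner ℝ (Z ω) (Z' ω)) P := by
  refine ((hZ.integrable_norm_pow (p := 2) (by norm_num)).add
    (hZ'.integrable_norm_pow (p := 2) (by norm_num))).mono'
    (hZ.1.inner hZ'.1) (Eventually.of_forall fun ω => ?_)
  have h1 := norm_inner_le_norm (𝕜 := ℝ) (Z ω) (Z' ω)
  simp only [Pi.add_apply]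
  nlinarith [sq_nonneg (‖Z ω‖ - ‖Z' ω‖), sq_nonneg ‖Z ω‖, sq_nonneg ‖Z' ω‖]

variable [IsProbabilityMeasure P] [CompleteSpace H]

lemma integral_sq_norm_sub_mean {Z : Ω → H} (hZ : MemLp Z 2 P) :
    ∫ ω, ‖Z ω - ∫ ω', Z ω' ∂P‖ ^ 2 ∂P = ∫ ω, ‖Z ω‖ ^ 2 ∂P - ‖∫ ω, Z ω ∂P‖ ^ 2 := by
  set m := ∫ ω', Z ω' ∂P with hm
  have hinteg : Integrable Z P := hZ.integrable (by norm_num)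
  have h1 : ∀ ω, ‖Z ω - m‖ ^ 2 = ‖Z ω‖ ^ 2 - 2 * inner ℝ m (Z ω) + ‖m‖ ^ 2 := fun ω => by
    rw [norm_sub_sq_real, real_inner_comm]
  simp_rw [h1]
  rw [integral_add, integral_sub, integral_const_mul, integral_inner hinteg, ← hm,
    real_inner_self_eq_norm_sq]
  · simp
    ring
  · exact hZ.integrable_norm_pow (by norm_num)
  · exact (hinteg.const_inner m).const_mul 2
  · exact (hZ.integrable_norm_pow (by norm_num)).sub ((hinteg.const_inner m).const_mul 2)
  · exact integrable_const _

/-- Polarization: correlations are determined by mean squared distances, which for embedded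
residuals are the moments `E|r_i - r_j|^α`. -/
lemma integral_inner_sub_mean {Z Z' : Ω → H} (hZ : MemLp Z 2 P) (hZ' : MemLp Z' 2 P) {m : H} {s : ℝ}
    (hm : ∫ ω, Z ω ∂P = m) (hm' : ∫ ω, Z' ω ∂P = m) (hs : ∫ ω, ‖Z ω‖ ^ 2 ∂P = s)
    (hs' : ∫ ω, ‖Z' ω‖ ^ 2 ∂P = s) :
    ∫ ω, inner ℝ (Z ω - m) (Z' ω - m) ∂P = s - ‖m‖ ^ 2 - (∫ ω, ‖Z ω - Z' ω‖ ^ 2 ∂P) / 2 := by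
  have h1 : ∀ ω, inner ℝ (Z ω - m) (Z' ω - m) =
      (‖Z ω - m‖ ^ 2 + ‖Z' ω - m‖ ^ 2 - ‖Z ω - Z' ω‖ ^ 2) / 2 := fun ω => by
    have h := norm_sub_sq_real (Z ω - m) (Z' ω - m)
    rw [sub_sub_sub_cancel_right] at h
    rw [h]
    ring
  have i1 : Integrable (fun ω => ‖Z ω - m‖ ^ 2) P :=
    (hZ.sub (memLp_const m)).integrable_norm_pow (by norm_num)
  have i2 : Integrable (fun ω => ‖Z' ω - m‖ ^ 2) P :=
    (hZ'.sub (memLp_const m)).integrable_norm_pow (by norm_num)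
  have i3 : Integrable (fun ω => ‖Z ω - Z' ω‖ ^ 2) P :=
    (hZ.sub hZ').integrable_norm_pow (by norm_num)
  simp_rw [h1]
  have v1 := integral_sq_norm_sub_mean hZ
  have v2 := integral_sq_norm_sub_mean hZ'
  rw [hm, hs] at v1
  rw [hm', hs'] at v2
  have h2 : ∫ ω, (‖Z ω - m‖ ^ 2 + ‖Z' ω - m‖ ^ 2 - ‖Z ω - Z' ω‖ ^ 2) ∂P =
      ∫ ω, (‖Z ω - m‖ ^ 2 + ‖Z' ω - m‖ ^ 2) ∂P - ∫ ω, ‖Z ω - Z' ω‖ ^ 2 ∂P :=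
    integral_sub (i1.add i2) i3
  rw [integral_div, h2, integral_add i1 i2, v1, v2]
  ring

lemma card_filter_abs_sub_lt_le (S : Finset ℕ) (i N : ℕ) :
    (S.filter fun j : ℕ => |(i : ℤ) - (j : ℤ)| < N).card ≤ 2 * N := by
  have h : (S.filter fun j : ℕ => |(i : ℤ) - (j : ℤ)| < N) ⊆ Finset.Ico (i + 1 - N) (i + N) := by
    intro j hj
    have := (Finset.mem_filter.1 hj).2
    rw [abs_lt] at this
    rw [Finset.mem_Ico]
    omega
  refine (Finset.card_le_card h).trans ?_
  rw [Nat.card_Ico]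
  omega

/-- Averages of centred variables vanish in mean square if their correlations vanish as the time
points move apart. -/
theorem tendstoInMeasure_sq_norm_average (Z : ℕ → ℕ → Ω → H) (S : ℕ → Finset ℕ)
    (hS : ∀ T, S T ⊆ Finset.Icc 1 T) (m : H) (s : ℝ)
    (hL2 : ∀ T, ∀ t ∈ S T, MemLp (Z T t) 2 P) (hm : ∀ T, ∀ t ∈ S T, ∫ ω, Z T t ω ∂P = m)
    (hs : ∀ T, ∀ t ∈ S T, ∫ ω, ‖Z T t ω‖ ^ 2 ∂P = s)
    (hpair : ∀ η > 0, ∃ N : ℕ, ∀ T, ∀ i ∈ S T, ∀ j ∈ S T, (N : ℤ) ≤ |(i : ℤ) - (j : ℤ)| →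
      |(∫ ω, ‖Z T i ω - Z T j ω‖ ^ 2 ∂P) - 2 * (s - ‖m‖ ^ 2)| < η) :
    TendstoInMeasure P (fun (T : ℕ) ω => ‖(T : ℝ)⁻¹ • ∑ t ∈ S T, (Z T t ω - m)‖ ^ 2) atTop
      (fun _ => 0) := by
  have hmem : ∀ T : ℕ, MemLp (fun ω => (T : ℝ)⁻¹ • ∑ t ∈ S T, (Z T t ω - m)) 2 P := fun T =>
    (memLp_finsetSum (S T) fun t ht => (hL2 T t ht).sub (memLp_const m)).const_smul _
  have hinteg : ∀ T : ℕ, Integrable (fun ω => ‖(T : ℝ)⁻¹ • ∑ t ∈ S T, (Z T t ω - m)‖ ^ 2) P := fun T =>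
    (hmem T).integrable_norm_pow (by norm_num)
  have hcard : ∀ T, ((S T).card : ℝ) ≤ T := fun T => by
    have := Finset.card_le_card (hS T)
    rw [Nat.card_Icc, Nat.add_sub_cancel] at this
    exact_mod_cast this
  have hexp : ∀ T : ℕ, ∫ ω, ‖(T : ℝ)⁻¹ • ∑ t ∈ S T, (Z T t ω - m)‖ ^ 2 ∂P = ((T : ℝ)⁻¹) ^ 2 *
      ∑ i ∈ S T, ∑ j ∈ S T, ∫ ω, inner ℝ (Z T i ω - m) (Z T j ω - m) ∂P := by
    intro T
    simp_rw [norm_smul, mul_pow, norm_inv, Real.norm_natCast]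
    rw [integral_const_mul]
    congr 1
    simp_rw [← real_inner_self_eq_norm_sq, sum_inner, inner_sum]
    have hi : ∀ i ∈ S T, ∀ j ∈ S T,
        Integrable (fun ω => inner ℝ (Z T i ω - m) (Z T j ω - m)) P := fun i hi j hj =>
      integrable_inner_of_memLp_two ((hL2 T i hi).sub (memLp_const m))
        ((hL2 T j hj).sub (memLp_const m))
    rw [integral_finsetSum _ fun i hi' => integrable_finsetSum _ fun j hj => hi i hi' j hj]
    exact Finset.sum_congr rfl fun i hi' => integral_finsetSum _ fun j hj => hi i hi' j hj
  have hlim : Tendsto (fun T : ℕ => ∫ ω, ‖(T : ℝ)⁻¹ • ∑ t ∈ S T, (Z T t ω - m)‖ ^ 2 ∂P) atTop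
      (𝓝 0) := by
    rw [Metric.tendsto_atTop]
    intro η hη
    obtain ⟨N, hN⟩ := hpair η hη
    set v := |s - ‖m‖ ^ 2| with hv
    -- Each row has at most `2 * N` near-diagonal pairs, contributing at most `2 * N * v / T`; this
    -- threshold brings that below `η / 2`. Distant pairs account for the other `η / 2`.
    obtain ⟨T₁, hT₁⟩ := exists_nat_gt (4 * N * v / η)
    refine ⟨T₁ + 1, fun T hT => ?_⟩
    have hT0 : (0 : ℝ) < T := by exact_mod_cast (by omega : 0 < T)
    have hnn : 0 ≤ ∫ ω, ‖(T : ℝ)⁻¹ • ∑ t ∈ S T, (Z T t ω - m)‖ ^ 2 ∂P :=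
      integral_nonneg fun ω => sq_nonneg _
    rw [Real.dist_eq, sub_zero, abs_of_nonneg hnn, hexp]
    have hterm : ∀ i ∈ S T, ∀ j ∈ S T, ∫ ω, inner ℝ (Z T i ω - m) (Z T j ω - m) ∂P ≤
        η / 2 + if |(i : ℤ) - (j : ℤ)| < N then v else 0 := by
      intro i hi j hj
      rw [integral_inner_sub_mean (hL2 T i hi) (hL2 T j hj) (hm T i hi) (hm T j hj) (hs T i hi)
        (hs T j hj)]
      split_ifs with h
      · have : 0 ≤ ∫ ω, ‖Z T i ω - Z T j ω‖ ^ 2 ∂P := integral_nonneg fun ω => sq_nonneg _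
        have := le_abs_self (s - ‖m‖ ^ 2)
        linarith
      · have := (abs_lt.1 (hN T i hi j hj (not_lt.1 h))).1
        linarith
    have hrow : ∀ i ∈ S T, ∑ j ∈ S T, ∫ ω, inner ℝ (Z T i ω - m) (Z T j ω - m) ∂P ≤
        T * (η / 2) + 2 * N * v := by
      intro i hi
      refine (Finset.sum_le_sum (hterm i hi)).trans ?_
      rw [Finset.sum_add_distrib, Finset.sum_const, ← Finset.sum_filter, Finset.sum_const,
        nsmul_eq_mul, nsmul_eq_mul]
      have h1 : ((S T).card : ℝ) * (η / 2) ≤ T * (η / 2) :=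
        mul_le_mul_of_nonneg_right (hcard T) (by linarith)
      have h2 : (((S T).filter fun j : ℕ => |(i : ℤ) - (j : ℤ)| < N).card : ℝ) * v ≤ 2 * N * v :=
        mul_le_mul_of_nonneg_right (by exact_mod_cast card_filter_abs_sub_lt_le (S T) i N)
          (abs_nonneg _)
      linarith
    have hv0 : 0 ≤ v := abs_nonneg _
    have hsum : ∑ i ∈ S T, ∑ j ∈ S T, ∫ ω, inner ℝ (Z T i ω - m) (Z T j ω - m) ∂P ≤
        T * (T * (η / 2) + 2 * N * v) := by
      refine (Finset.sum_le_sum hrow).trans ?_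
      rw [Finset.sum_const, nsmul_eq_mul]
      exact mul_le_mul_of_nonneg_right (hcard T) (by positivity)
    have hTbig : 4 * N * v < T * η := by
      have h1 : (T₁ : ℝ) < T := by exact_mod_cast hT
      rw [div_lt_iff₀ hη] at hT₁
      nlinarith
    calc ((T : ℝ)⁻¹) ^ 2 * ∑ i ∈ S T, ∑ j ∈ S T, ∫ ω, inner ℝ (Z T i ω - m) (Z T j ω - m) ∂P
        ≤ ((T : ℝ)⁻¹) ^ 2 * (T * (T * (η / 2) + 2 * N * v)) :=
          mul_le_mul_of_nonneg_left hsum (by positivity)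
      _ = (T * (η / 2) + 2 * N * v) / T := by field_simp
      _ < η := by
          rw [div_lt_iff₀ hT0]
          linarith
  refine tendstoInMeasure_of_tendsto_eLpNorm (p := 1) one_ne_zero
    (fun T => (hinteg T).aestronglyMeasurable) aestronglyMeasurable_const ?_
  have he : ∀ T : ℕ, eLpNorm ((fun ω => ‖(T : ℝ)⁻¹ • ∑ t ∈ S T, (Z T t ω - m)‖ ^ 2) - fun _ => 0) 1 P
      = ENNReal.ofReal (∫ ω, ‖(T : ℝ)⁻¹ • ∑ t ∈ S T, (Z T t ω - m)‖ ^ 2 ∂P) := by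
    intro T
    rw [eLpNorm_one_eq_lintegral_enorm, ofReal_integral_eq_lintegral_ofReal (hinteg T)
      (Eventually.of_forall fun ω => sq_nonneg _)]
    refine lintegral_congr fun ω => ?_
    simp only [Pi.sub_apply, sub_zero]
    exact Real.enorm_of_nonneg (sq_nonneg _)
  simp_rw [he]
  simpa using ENNReal.tendsto_ofReal hlim

end LawOfLargeNumbers

/-! ### Passing to subsequences -/

/-- Nested extraction, one function at a time, so that finitely many limits hold along the same
path. -/
lemma exists_subseq_ae_tendsto {Ω : Type*} [MeasurableSpace Ω] {P : Measure Ω}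
    (l : List (ℕ → Ω → ℝ)) (h : ∀ f ∈ l, TendstoInMeasure P f atTop fun _ => 0) :
    ∃ ns : ℕ → ℕ, StrictMono ns ∧
      ∀ᵐ ω ∂P, ∀ f ∈ l, Tendsto (fun i => f (ns i) ω) atTop (𝓝 0) := by
  induction l with
  | nil => exact ⟨id, strictMono_id, by simp⟩
  | cons f l ih =>
    obtain ⟨ns, hns, hae⟩ := ih fun g hg => h g (List.mem_cons_of_mem _ hg)
    obtain ⟨ms, hms, hae'⟩ :=
      ((h f List.mem_cons_self).comp hns.tendsto_atTop).exists_seq_tendsto_ae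
    refine ⟨ns ∘ ms, hns.comp hms, ?_⟩
    filter_upwards [hae, hae'] with ω h1 h2 g hg
    rcases List.mem_cons.1 hg with rfl | hg
    · exact h2
    · exact (h1 g hg).comp hms.tendsto_atTop

/-- Turns limits in different spaces into real null sequences, which can share one list. -/
lemma tendstoInMeasure_dist {Ω E : Type*} [MeasurableSpace Ω] {P : Measure Ω} [PseudoMetricSpace E]
    {f : ℕ → Ω → E} {c : E} (h : TendstoInMeasure P f atTop fun _ => c) :
    TendstoInMeasure P (fun T ω => dist (f T ω) c) atTop fun _ => 0 := by
  rw [tendstoInMeasure_iff_dist] at h ⊢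
  simpa only [Real.dist_0_eq_abs, abs_of_nonneg dist_nonneg] using h

/-- A sequence that is bounded in mean is bounded along a subsequence, almost surely. -/
lemma ae_exists_subseq_bounded {Ω : Type*} [MeasurableSpace Ω] {P : Measure Ω} {W : ℕ → Ω → ℝ}
    (hmeas : ∀ i, Measurable (W i)) {C : ℝ} (hC : ∀ i, ∫⁻ ω, ENNReal.ofReal (W i ω) ∂P ≤ ENNReal.ofReal C) :
    ∀ᵐ ω ∂P, ∃ B : ℝ, ∃ ms : ℕ → ℕ, StrictMono ms ∧ ∀ i, W (ms i) ω ≤ B := by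
  -- Fatou's lemma makes the liminf finite almost surely. The subsequence obtained from it depends
  -- on `ω`.
  have h1 : ∫⁻ ω, liminf (fun i => ENNReal.ofReal (W i ω)) atTop ∂P ≤ ENNReal.ofReal C :=
    (lintegral_liminf_le fun i => (hmeas i).ennreal_ofReal).trans
      (liminf_le_of_le (by isBoundedDefault) fun b hb => by
        obtain ⟨i, hi⟩ := hb.exists
        exact hi.trans (hC i))
  have h2 := ae_lt_top (Measurable.liminf fun i => (hmeas i).ennreal_ofReal)
    (h1.trans_lt ENNReal.ofReal_lt_top).ne
  filter_upwards [h2] with ω hω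
  obtain ⟨B, hB, hBtop⟩ := exists_between hω
  have h3 : ∃ᶠ i in atTop, ENNReal.ofReal (W i ω) < B := frequently_lt_of_liminf_lt (by isBoundedDefault) hB
  obtain ⟨ms, hms, hlt⟩ := extraction_of_frequently_atTop h3
  refine ⟨B.toReal, ms, hms, fun i => ?_⟩
  have := hlt i
  by_cases hW : 0 ≤ W (ms i) ω
  · exact (ENNReal.ofReal_le_iff_le_toReal hBtop.ne).1 this.le
  · exact (not_le.1 hW).le.trans ENNReal.toReal_nonneg

/-! ### Averages over perturbed index sets -/

lemma norm_sum_sq_le {ι H : Type*} [SeminormedAddCommGroup H] (A : Finset ι) (z : ι → H) :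
    ‖∑ t ∈ A, z t‖ ^ 2 ≤ A.card * ∑ t ∈ A, ‖z t‖ ^ 2 :=
  (pow_le_pow_left₀ (norm_nonneg _) (norm_sum_le A z) 2).trans sq_sum_le_card_mul_sum_sq

lemma tendsto_zero_of_sq_norm {ι H : Type*} [SeminormedAddCommGroup H] {l : Filter ι} {f : ι → H}
    {g : ι → ℝ} (h : ∀ i, ‖f i‖ ^ 2 ≤ g i) (hg : Tendsto g l (𝓝 0)) : Tendsto f l (𝓝 0) := by
  rw [tendsto_zero_iff_norm_tendsto_zero]
  have h1 : Tendsto (fun i => √(g i)) l (𝓝 0) := by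
    simpa [Function.comp_def] using (Real.continuous_sqrt.tendsto 0).comp hg
  exact squeeze_zero (fun i => norm_nonneg _) (fun i => Real.le_sqrt_of_sq_le (h i)) h1

section PerturbedAverages

variable {H : Type*} [NormedAddCommGroup H]

lemma sum_sub_sum_eq_sum_symmDiff (A A' : Finset ℕ) (z : ℕ → H) :
    ∑ t ∈ A, z t - ∑ t ∈ A', z t = ∑ t ∈ symmDiff A A', if t ∈ A then z t else -z t := by
  have hd : Disjoint (A \ A') (A' \ A) := disjoint_sdiff_sdiff
  rw [← Finset.sum_sdiff_sub_sum_sdiff, symmDiff, Finset.sup_eq_union, Finset.sum_union hd,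
    sub_eq_add_neg, ← Finset.sum_neg_distrib]
  congr 1 <;> refine Finset.sum_congr rfl fun t ht => ?_
  · rw [if_pos (Finset.mem_sdiff.1 ht).1]
  · rw [if_neg (Finset.mem_sdiff.1 ht).2]

lemma card_le_of_subset_Icc {A : Finset ℕ} {n : ℕ} (h : A ⊆ Finset.Icc 1 n) :
    (A.card : ℝ) ≤ n := by
  have := Finset.card_le_card h
  rw [Nat.card_Icc, Nat.add_sub_cancel] at this
  exact_mod_cast this

variable {N : ℕ → ℕ} {S S' : ℕ → Finset ℕ} {z z' : ℕ → ℕ → H} {m : H} {v B : ℝ}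

/-- One factor `1 / N` makes the average of squares bounded, and the second sends it to `0`. This
disposes of the correction terms in `le_energy`. -/
lemma tendsto_sum_sq_norm_div_sq (hN : Tendsto N atTop atTop)
    (hS : ∀ i, S i ⊆ Finset.Icc 1 (N i))
    (hzz : Tendsto (fun i => (N i : ℝ)⁻¹ * ∑ t ∈ S i, ‖z i t - z' i t‖ ^ 2) atTop (𝓝 0))
    (hB : ∀ i, (N i : ℝ)⁻¹ * ∑ t ∈ Finset.Icc 1 (N i), ‖z' i t‖ ^ 2 ≤ B) :
    Tendsto (fun i => (∑ t ∈ S i, ‖z i t‖ ^ 2) / (N i : ℝ) ^ 2) atTop (𝓝 0) := by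
  have hinv : Tendsto (fun i => (N i : ℝ)⁻¹) atTop (𝓝 0) :=
    tendsto_inv_atTop_zero.comp (tendsto_natCast_atTop_atTop.comp hN)
  refine squeeze_zero (g := fun i => (N i : ℝ)⁻¹ *
    (2 * ((N i : ℝ)⁻¹ * ∑ t ∈ S i, ‖z i t - z' i t‖ ^ 2) + 2 * B)) (fun i => by positivity)
    (fun i => ?_) (by simpa using hinv.mul ((hzz.const_mul 2).add_const (2 * B)))
  have h1 : ∑ t ∈ S i, ‖z i t‖ ^ 2 ≤ 2 * ∑ t ∈ S i, ‖z i t - z' i t‖ ^ 2 +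
      2 * ∑ t ∈ Finset.Icc 1 (N i), ‖z' i t‖ ^ 2 := by
    have h2 : ∑ t ∈ S i, ‖z' i t‖ ^ 2 ≤ ∑ t ∈ Finset.Icc 1 (N i), ‖z' i t‖ ^ 2 :=
      Finset.sum_le_sum_of_subset_of_nonneg (hS i) fun t _ _ => sq_nonneg _
    have h3 : ∑ t ∈ S i, ‖z i t‖ ^ 2 ≤
        ∑ t ∈ S i, (2 * ‖z i t - z' i t‖ ^ 2 + 2 * ‖z' i t‖ ^ 2) := by
      refine Finset.sum_le_sum fun t _ => ?_
      have h4 := norm_add_le (z i t - z' i t) (z' i t)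
      rw [sub_add_cancel] at h4
      nlinarith [sq_nonneg (‖z i t - z' i t‖ - ‖z' i t‖), norm_nonneg (z i t)]
    rw [Finset.sum_add_distrib, ← Finset.mul_sum, ← Finset.mul_sum] at h3
    linarith
  have h0 : (0 : ℝ) ≤ (N i : ℝ)⁻¹ := by positivity
  calc (∑ t ∈ S i, ‖z i t‖ ^ 2) / (N i : ℝ) ^ 2
      = (N i : ℝ)⁻¹ * ((N i : ℝ)⁻¹ * ∑ t ∈ S i, ‖z i t‖ ^ 2) := by
        rw [div_eq_inv_mul, sq, mul_inv, mul_assoc]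
    _ ≤ (N i : ℝ)⁻¹ * (2 * ((N i : ℝ)⁻¹ * ∑ t ∈ S i, ‖z i t - z' i t‖ ^ 2) + 2 * B) := by
        refine mul_le_mul_of_nonneg_left ?_ h0
        have := mul_le_mul_of_nonneg_left h1 h0
        have := hB i
        linarith

variable [NormedSpace ℝ H]

lemma sq_norm_inv_smul_sum_le (A : Finset ℕ) (n : ℕ) (z : ℕ → H) :
    ‖(n : ℝ)⁻¹ • ∑ t ∈ A, z t‖ ^ 2 ≤ ((A.card : ℝ) / n) * ((n : ℝ)⁻¹ * ∑ t ∈ A, ‖z t‖ ^ 2) := by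
  rw [norm_smul, mul_pow, norm_inv, Real.norm_natCast]
  calc ((n : ℝ)⁻¹) ^ 2 * ‖∑ t ∈ A, z t‖ ^ 2
      ≤ ((n : ℝ)⁻¹) ^ 2 * (A.card * ∑ t ∈ A, ‖z t‖ ^ 2) :=
        mul_le_mul_of_nonneg_left (norm_sum_sq_le A z) (by positivity)
    _ = _ := by ring

/-- Replace `z` by `z'` (estimated by limiting coefficients), then `S` by `S'` (random by
deterministic segments), then centre at `m`. -/
theorem tendsto_average_of_perturbation
    (hS : ∀ i, S i ⊆ Finset.Icc 1 (N i)) (hS' : ∀ i, S' i ⊆ Finset.Icc 1 (N i))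
    (hzz : Tendsto (fun i => (N i : ℝ)⁻¹ * ∑ t ∈ S i, ‖z i t - z' i t‖ ^ 2) atTop (𝓝 0))
    (hB : ∀ i, (N i : ℝ)⁻¹ * ∑ t ∈ Finset.Icc 1 (N i), ‖z' i t‖ ^ 2 ≤ B)
    (hSS : Tendsto (fun i => ((symmDiff (S i) (S' i)).card : ℝ) / N i) atTop (𝓝 0))
    (hm : Tendsto (fun i => ‖(N i : ℝ)⁻¹ • ∑ t ∈ S' i, (z' i t - m)‖ ^ 2) atTop (𝓝 0))
    (hv : Tendsto (fun i => ((S' i).card : ℝ) / N i) atTop (𝓝 v)) :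
    Tendsto (fun i => (N i : ℝ)⁻¹ • ∑ t ∈ S i, z i t) atTop (𝓝 (v • m)) := by
  have hdecomp : ∀ i, (N i : ℝ)⁻¹ • ∑ t ∈ S i, z i t =
      (N i : ℝ)⁻¹ • ∑ t ∈ S i, (z i t - z' i t) +
      (N i : ℝ)⁻¹ • (∑ t ∈ S i, z' i t - ∑ t ∈ S' i, z' i t) +
      (N i : ℝ)⁻¹ • ∑ t ∈ S' i, (z' i t - m) + (((S' i).card : ℝ) / N i) • m := by
    intro i
    rw [Finset.sum_sub_distrib, Finset.sum_sub_distrib, Finset.sum_const, div_eq_inv_mul, mul_smul,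
      ← Nat.cast_smul_eq_nsmul ℝ, ← smul_add, ← smul_add, ← smul_add]
    congr 1
    abel
  have t1 : Tendsto (fun i => (N i : ℝ)⁻¹ • ∑ t ∈ S i, (z i t - z' i t)) atTop (𝓝 0) := by
    refine tendsto_zero_of_sq_norm (fun i => ?_) hzz
    refine (sq_norm_inv_smul_sum_le _ _ _).trans (mul_le_of_le_one_left (by positivity) ?_)
    exact div_le_one_of_le₀ (card_le_of_subset_Icc (hS i)) (Nat.cast_nonneg _)
  have t2 : Tendsto (fun i => (N i : ℝ)⁻¹ • (∑ t ∈ S i, z' i t - ∑ t ∈ S' i, z' i t)) atTop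
      (𝓝 0) := by
    -- By Cauchy–Schwarz a vanishing fraction of indices contributes nothing, given only bounded
    -- average squares.
    refine tendsto_zero_of_sq_norm (g := fun i => ((symmDiff (S i) (S' i)).card : ℝ) / N i * B)
      (fun i => ?_) (by simpa using hSS.mul_const B)
    rw [sum_sub_sum_eq_sum_symmDiff]
    refine (sq_norm_inv_smul_sum_le _ _ _).trans (mul_le_mul_of_nonneg_left ?_ (by positivity))
    refine le_trans (mul_le_mul_of_nonneg_left ?_ (by positivity)) (hB i)
    have hn : ∀ t, ‖if t ∈ S i then z' i t else -z' i t‖ = ‖z' i t‖ := fun t => by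
      split_ifs <;> simp
    simp_rw [hn]
    refine Finset.sum_le_sum_of_subset_of_nonneg ?_ fun t _ _ => sq_nonneg _
    intro t ht
    rcases Finset.mem_symmDiff.1 ht with h | h
    · exact hS i h.1
    · exact hS' i h.1
  have t3 : Tendsto (fun i => (N i : ℝ)⁻¹ • ∑ t ∈ S' i, (z' i t - m)) atTop (𝓝 0) :=
    tendsto_zero_of_sq_norm (fun i => le_rfl) hm
  have := ((t1.add t2).add t3).add (hv.smul_const m)
  simp_rw [hdecomp]
  simpa using this

end PerturbedAverages

/-! ### The fitted values -/

section Fit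

variable {p q : ℕ}

lemma fit_sub (x : Vec p) (b c : Coef p q) : fit x (b - c) = fit x b - fit x c := by
  simp [fit, Matrix.vecMul_sub]

lemma fit_zero (x : Vec p) : fit x (0 : Coef p q) = 0 := by
  simp [fit]

lemma norm_fit_le (x : Vec p) (b : Coef p q) : ‖fit x b‖ ≤ ‖x‖ * ‖b‖ := by
  have h := Matrix.l2_opNorm_mulVec b.conjTranspose x
  rw [Matrix.l2_opNorm_conjTranspose, mul_comm, Matrix.conjTranspose_eq_transpose_of_trivial,
    Matrix.mulVec_transpose] at h
  exact h

lemma continuous_fit (b : Coef p q) : Continuous fun x : Vec p => fit x b := by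
  unfold fit
  fun_prop

end Fit

/-! ### Moment bounds -/

lemma rpow_add_le_two_rpow_mul {a b α : ℝ} (ha : 0 ≤ a) (hb : 0 ≤ b) (hα : 0 ≤ α) :
    (a + b) ^ α ≤ 2 ^ α * (a ^ α + b ^ α) := by
  have key : ∀ c d : ℝ, 0 ≤ c → 0 ≤ d → c ≤ d → (c + d) ^ α ≤ 2 ^ α * (c ^ α + d ^ α) := by
    intro c d hc hd hcd
    calc (c + d) ^ α ≤ (2 * d) ^ α := Real.rpow_le_rpow (by positivity) (by linarith) hα
      _ = 2 ^ α * d ^ α := Real.mul_rpow (by norm_num) hd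
      _ ≤ 2 ^ α * (c ^ α + d ^ α) := by
        have := Real.rpow_nonneg hc α
        gcongr
        linarith
  rcases le_total a b with h | h
  · exact key a b ha hb h
  · rw [add_comm a b, add_comm (a ^ α)]
    exact key b a hb ha h

/-- The constant in `norm_add_fit_rpow_le`. -/
def growthConst {p q : ℕ} (α : ℝ) (d : Coef p q) : ℝ := 2 ^ α * (1 + ‖d‖ ^ α)

lemma norm_add_fit_rpow_le {p q : ℕ} {α : ℝ} (hα : 0 ≤ α) (u : Vec q) (x : Vec p) (d : Coef p q) :
    ‖u + fit x d‖ ^ α ≤ growthConst α d * (1 + ‖u‖ ^ α + ‖x‖ ^ α) := by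
  have h1 : ‖u + fit x d‖ ^ α ≤ (‖u‖ + ‖x‖ * ‖d‖) ^ α :=
    Real.rpow_le_rpow (norm_nonneg _)
      ((norm_add_le _ _).trans (add_le_add_right (norm_fit_le x d) _)) hα
  have h2 := rpow_add_le_two_rpow_mul (norm_nonneg u)
    (mul_nonneg (norm_nonneg x) (norm_nonneg d)) hα
  rw [Real.mul_rpow (norm_nonneg _) (norm_nonneg _)] at h2
  refine (h1.trans h2).trans ?_
  unfold growthConst
  rw [mul_assoc]
  have hu := Real.rpow_nonneg (norm_nonneg u) α
  have hx := Real.rpow_nonneg (norm_nonneg x) α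
  have hd := Real.rpow_nonneg (norm_nonneg d) α
  gcongr
  nlinarith [mul_nonneg hu hd]

lemma growthConst_nonneg {p q : ℕ} (α : ℝ) (d : Coef p q) : 0 ≤ growthConst α d := by
  unfold growthConst
  positivity

lemma integrable_norm_rpow_of_two_mul {S E : Type*} [MeasurableSpace S] [NormedAddCommGroup E]
    {μ : Measure S} [IsFiniteMeasure μ] {f : S → E} {α : ℝ}
    (hf : AEStronglyMeasurable f μ) (h : Integrable (fun s => ‖f s‖ ^ (2 * α)) μ) :
    Integrable (fun s => ‖f s‖ ^ α) μ := by
  refine ((integrable_const 1).add h).mono'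
    ((hf.norm.aemeasurable.pow_const α).aestronglyMeasurable) (Eventually.of_forall fun s => ?_)
  have h1 : ‖f s‖ ^ (2 * α) = (‖f s‖ ^ α) ^ 2 := by
    rw [mul_comm, Real.rpow_mul (norm_nonneg _)]
    norm_cast
  simp only [Pi.add_apply]
  rw [h1, Real.norm_of_nonneg (Real.rpow_nonneg (norm_nonneg _) _)]
  nlinarith [sq_nonneg (‖f s‖ ^ α - 1)]

/-- `limitY` groups the variables as `(U, U~), (X, X~)`; independent copies of a residual group them
as `(U, X), (U~, X~)`. -/
lemma map_prod_rearrange {A B C D : Type*} [MeasurableSpace A] [MeasurableSpace B]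
    [MeasurableSpace C] [MeasurableSpace D] (μ : Measure A) (ν : Measure B) (ρ : Measure C)
    (σ : Measure D) [SFinite μ] [SFinite ν] [SFinite ρ] [SFinite σ] :
    ((μ.prod ν).prod (ρ.prod σ)).map
      (fun z : (A × B) × (C × D) => ((z.1.1, z.2.1), (z.1.2, z.2.2))) =
      (μ.prod ρ).prod (ν.prod σ) := by
  refine Measure.ext_of_lintegral _ fun f hf => ?_
  rw [lintegral_map hf (by fun_prop), lintegral_prod _ (by fun_prop), lintegral_prod _ (by fun_prop),
    lintegral_prod _ (by fun_prop), lintegral_prod _ (by fun_prop)]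
  refine lintegral_congr fun a => ?_
  have h1 : ∀ b : B, ∫⁻ y : C × D, f ((a, y.1), (b, y.2)) ∂(ρ.prod σ) =
      ∫⁻ c, ∫⁻ d, f ((a, c), (b, d)) ∂σ ∂ρ := fun b => lintegral_prod _ (by fun_prop)
  have h2 : ∀ c : C, ∫⁻ y : B × D, f ((a, c), y) ∂(ν.prod σ) =
      ∫⁻ b, ∫⁻ d, f ((a, c), (b, d)) ∂σ ∂ν := fun c => lintegral_prod _ (by fun_prop)
  simp_rw [h1, h2]
  exact lintegral_lintegral_swap (by fun_prop)

/-! ### Embeddings of the kernel -/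

section Kernel

variable {q : ℕ} {α : ℝ} {H : Type*} [NormedAddCommGroup H] {K : Vec q → H}

lemma continuous_embedding (hα : 0 < α) (hK : ∀ x y, ‖K x - K y‖ ^ 2 = ‖x - y‖ ^ α) :
    Continuous K := by
  refine continuous_iff_continuousAt.2 fun y => ?_
  have h1 : Tendsto (fun x => ‖x - y‖ ^ α) (𝓝 y) (𝓝 0) := by
    have : Continuous fun x : Vec q => ‖x - y‖ ^ α :=
      (continuous_id.sub continuous_const).norm.rpow_const fun _ => Or.inr hα.le
    simpa [hα.ne'] using this.tendsto y
  have h2 := tendsto_zero_of_sq_norm (f := fun x => K x - K y) (fun x => (hK x y).le) h1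
  exact tendsto_sub_nhds_zero_iff.1 h2

lemma sq_norm_embedding (hK0 : K 0 = 0) (hK : ∀ x y, ‖K x - K y‖ ^ 2 = ‖x - y‖ ^ α) (x : Vec q) :
    ‖K x‖ ^ 2 = ‖x‖ ^ α := by
  simpa [hK0] using hK x 0

end Kernel

/-! ### Segments -/

section Segments

lemma mem_segment_zero {T τ t : ℕ} : t ∈ segment T τ 0 ↔ 1 ≤ t ∧ t ≤ τ := by
  simp [segment]

lemma mem_segment_one {T τ t : ℕ} : t ∈ segment T τ 1 ↔ τ + 1 ≤ t ∧ t ≤ T := by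
  simp [segment]

lemma segment_subset_Icc {T τ : ℕ} (hτ : τ ≤ T) (j : Fin 2) :
    segment T τ j ⊆ Finset.Icc 1 T := by
  intro t ht
  rw [Finset.mem_Icc]
  fin_cases j
  · have := mem_segment_zero.1 ht
    omega
  · have := mem_segment_one.1 ht
    omega

lemma segIndex_of_mem_segment {T τ t : ℕ} {j : Fin 2} (ht : t ∈ segment T τ j) :
    segIndex τ t = j := by
  fin_cases j
  · have := mem_segment_zero.1 ht
    simp [segIndex, this.2]
  · have := mem_segment_one.1 ht
    simp [segIndex, show ¬ t ≤ τ by omega]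

/-- The fraction of segment `j` for the change point fraction `l`. -/
def segFraction (l : ℝ) (j : Fin 2) : ℝ := if j = 0 then l else 1 - l

lemma card_segment_div {T τ : ℕ} (hT : T ≠ 0) (hτ : τ ≤ T) (j : Fin 2) :
    ((segment T τ j).card : ℝ) / T = segFraction ((τ : ℝ) / T) j := by
  have hT' : (T : ℝ) ≠ 0 := by exact_mod_cast hT
  fin_cases j
  · simp [segment, segFraction]
  · simp [segment, segFraction, Nat.cast_sub hτ, sub_div, hT']

lemma card_symmDiff_segment_le (T τ τ' : ℕ) (j : Fin 2) :
    ((symmDiff (segment T τ j) (segment T τ' j)).card : ℝ) ≤ |(τ : ℝ) - τ'| := by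
  have h : symmDiff (segment T τ j) (segment T τ' j) ⊆ Finset.Ioc (min τ τ') (max τ τ') := by
    intro t ht
    rw [Finset.mem_symmDiff] at ht
    rw [Finset.mem_Ioc]
    fin_cases j
    · simp only [Fin.zero_eta, mem_segment_zero] at ht
      omega
    · simp only [Fin.mk_one, mem_segment_one] at ht
      omega
  have h1 := Finset.card_le_card h
  rw [Nat.card_Ioc] at h1
  have h2 : ((max τ τ' - min τ τ' : ℕ) : ℝ) = |(τ : ℝ) - τ'| := by
    rw [Nat.cast_sub min_le_max, Nat.cast_max, Nat.cast_min, max_sub_min_eq_abs, abs_sub_comm]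
  rw [← h2]
  exact_mod_cast h1

lemma symmDiff_sdiff_subset (R A A' : Finset ℕ) : symmDiff (R \ A) (R \ A') ⊆ symmDiff A A' := by
  intro t ht
  simp only [Finset.mem_symmDiff, Finset.mem_sdiff] at ht ⊢
  tauto

/-- If segment `j` shrinks, the opposite one straddles `τ₀`. General `j ≠ j'` treats candidates on
either side of the true change point at once. -/
lemma segment_eq_union {T τ τ₀ : ℕ} {j j' : Fin 2} (hj : j ≠ j') (hτ : τ ≤ T) (hτ₀ : τ₀ ≤ T)
    (h : segment T τ j ⊆ segment T τ₀ j) :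
    segment T τ j' = (segment T τ₀ j \ segment T τ j) ∪ segment T τ₀ j' := by
  ext t
  have ht := @h t
  simp only [Finset.mem_union, Finset.mem_sdiff]
  fin_cases j <;> fin_cases j' <;>
    simp only [Fin.zero_eta, Fin.mk_one, mem_segment_zero, mem_segment_one, ne_eq,
      not_true_eq_false] at hj ht ⊢ <;> omega

lemma disjoint_segment {T τ : ℕ} {j j' : Fin 2} (hj : j ≠ j') :
    Disjoint (segment T τ j) (segment T τ j') := by
  rw [Finset.disjoint_left]
  intro t h1 h2
  exact hj ((segIndex_of_mem_segment h1).symm.trans (segIndex_of_mem_segment h2))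

end Segments

/-! ### Residuals as disturbances plus coefficient errors -/

namespace Model

variable {Ω : Type*} {p q : ℕ} (M : Model Ω p q)

/-- The disturbance plus the fitted value for the coefficients `d`. -/
def shifted (d : Coef p q) (T t : ℕ) (ω : Ω) : Vec q := M.u t ω + fit (M.x T t ω) d

/-- The law of `shifted d` in regime `k`. -/
def shiftedLaw (k : Fin 2) (d : Coef p q) : Measure (Vec q) :=
  M.lawU.conv ((M.lawX k).map fun x => fit x d)

lemma residual_eq_shifted {T τ t : ℕ} {j k : Fin 2} (hk : t ∈ segment T (M.T0 T) k)
    (hj : t ∈ segment T τ j) (ω : Ω) (b : Fin 2 → Coef p q) :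
    M.residual T τ ω b t = M.shifted (M.beta0 k - b j) T t ω := by
  rw [residual, y, shifted, segIndex_of_mem_segment hk, segIndex_of_mem_segment hj, fit_sub]
  abel

lemma T0_le (h : M.lam0 ≤ 1) (T : ℕ) : M.T0 T ≤ T := by
  unfold T0
  refine Nat.floor_le_of_le ?_
  nlinarith [Nat.cast_nonneg (α := ℝ) T]

lemma tendsto_floor_mul_div {l : ℝ} (hl : 0 ≤ l) :
    Tendsto (fun T : ℕ => (⌊(T : ℝ) * l⌋₊ : ℝ) / T) atTop (𝓝 l) := by
  have := (tendsto_nat_floor_mul_div_atTop hl).comp (tendsto_natCast_atTop_atTop (R := ℝ))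
  simpa [Function.comp_def, mul_comm] using this

/-- The average size of the data, which dominates all empirical averages. -/
def sizeAverage (α : ℝ) (T : ℕ) (ω : Ω) : ℝ :=
  (T : ℝ)⁻¹ * ∑ t ∈ Finset.Icc 1 T, (1 + ‖M.u t ω‖ ^ α + ‖M.x T t ω‖ ^ α)

end Model

namespace Model

variable {Ω : Type*} {p q : ℕ} (M : Model Ω p q)

/-! ### Limits of residual averages along a fixed path -/

section PathwiseLimits

variable {α : ℝ} {H : Type*} [NormedAddCommGroup H] {K : Vec q → H}

lemma shifted_sub_shifted (d d' : Coef p q) (T t : ℕ) (ω : Ω) :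
    M.shifted d T t ω - M.shifted d' T t ω = fit (M.x T t ω) (d - d') := by
  rw [shifted, shifted, fit_sub]
  abel

lemma average_sq_norm_shifted_le (hα : 0 < α) (hK0 : K 0 = 0)
    (hK : ∀ x y, ‖K x - K y‖ ^ 2 = ‖x - y‖ ^ α) (d : Coef p q) (T : ℕ) (ω : Ω) :
    (T : ℝ)⁻¹ * ∑ t ∈ Finset.Icc 1 T, ‖K (M.shifted d T t ω)‖ ^ 2 ≤
      growthConst α d * M.sizeAverage α T ω := by
  rw [sizeAverage, mul_left_comm, Finset.mul_sum _ _ (growthConst α d)]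
  have h0 : (0 : ℝ) ≤ (T : ℝ)⁻¹ := by positivity
  refine mul_le_mul_of_nonneg_left (Finset.sum_le_sum fun t _ => ?_) h0
  rw [sq_norm_embedding hK0 hK]
  exact norm_add_fit_rpow_le hα.le _ _ _

/-- The kernel identity makes the dependence on coefficients Hölder in mean square, so estimated
coefficients need no law of large numbers uniform in `d`. -/
lemma average_sq_norm_shifted_sub_le (hα : 0 < α) (hK : ∀ x y, ‖K x - K y‖ ^ 2 = ‖x - y‖ ^ α)
    (d d' : Coef p q) {T : ℕ} {S : Finset ℕ} (hS : S ⊆ Finset.Icc 1 T) (ω : Ω) :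
    (T : ℝ)⁻¹ * ∑ t ∈ S, ‖K (M.shifted d T t ω) - K (M.shifted d' T t ω)‖ ^ 2 ≤
      ‖d - d'‖ ^ α * M.sizeAverage α T ω := by
  rw [sizeAverage, mul_left_comm, Finset.mul_sum _ _ (‖d - d'‖ ^ α)]
  have h0 : (0 : ℝ) ≤ (T : ℝ)⁻¹ := by positivity
  refine mul_le_mul_of_nonneg_left ?_ h0
  refine (Finset.sum_le_sum_of_subset_of_nonneg hS fun t _ _ => sq_nonneg _).trans
    (Finset.sum_le_sum fun t _ => ?_)
  rw [hK, shifted_sub_shifted]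
  have h1 : ‖fit (M.x T t ω) (d - d')‖ ^ α ≤ (‖M.x T t ω‖ * ‖d - d'‖) ^ α :=
    Real.rpow_le_rpow (norm_nonneg _) (norm_fit_le _ _) hα.le
  rw [Real.mul_rpow (norm_nonneg _) (norm_nonneg _), mul_comm] at h1
  refine h1.trans (mul_le_mul_of_nonneg_left ?_ (Real.rpow_nonneg (norm_nonneg _) _))
  have := Real.rpow_nonneg (norm_nonneg (M.u t ω)) α
  linarith

variable {N : ℕ → ℕ} {S S' : ℕ → Finset ℕ} {d : ℕ → Coef p q} {d₀ : Coef p q} {ω : Ω} {B : ℝ}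

lemma tendsto_average_sq_norm_sub (hα : 0 < α) (hK : ∀ x y, ‖K x - K y‖ ^ 2 = ‖x - y‖ ^ α)
    (hB : ∀ i, M.sizeAverage α (N i) ω ≤ B) (hS : ∀ i, S i ⊆ Finset.Icc 1 (N i))
    (hd : Tendsto d atTop (𝓝 d₀)) :
    Tendsto (fun i => (N i : ℝ)⁻¹ * ∑ t ∈ S i,
      ‖K (M.shifted (d i) (N i) t ω) - K (M.shifted d₀ (N i) t ω)‖ ^ 2) atTop (𝓝 0) := by
  have h1 : Tendsto (fun i => ‖d i - d₀‖ ^ α * B) atTop (𝓝 0) := by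
    have h2 : Tendsto (fun i => ‖d i - d₀‖) atTop (𝓝 0) :=
      tendsto_iff_norm_sub_tendsto_zero.1 hd
    have h3 := (h2.rpow_const (Or.inr hα.le)).mul_const B
    rwa [Real.zero_rpow hα.ne', zero_mul] at h3
  refine squeeze_zero (fun i => by positivity) (fun i => ?_) h1
  exact (M.average_sq_norm_shifted_sub_le hα hK _ _ (hS i) ω).trans
    (mul_le_mul_of_nonneg_left (hB i) (Real.rpow_nonneg (norm_nonneg _) _))

lemma average_sq_norm_shifted_le_of_le (hα : 0 < α) (hK0 : K 0 = 0)
    (hK : ∀ x y, ‖K x - K y‖ ^ 2 = ‖x - y‖ ^ α) (hB : ∀ i, M.sizeAverage α (N i) ω ≤ B) (i : ℕ) :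
    (N i : ℝ)⁻¹ * ∑ t ∈ Finset.Icc 1 (N i), ‖K (M.shifted d₀ (N i) t ω)‖ ^ 2 ≤
      growthConst α d₀ * B :=
  (M.average_sq_norm_shifted_le hα hK0 hK d₀ (N i) ω).trans
    (mul_le_mul_of_nonneg_left (hB i) (growthConst_nonneg _ _))

theorem tendsto_average_shifted [NormedSpace ℝ H] (hα : 0 < α) (hK0 : K 0 = 0)
    (hK : ∀ x y, ‖K x - K y‖ ^ 2 = ‖x - y‖ ^ α)
    (hB : ∀ i, M.sizeAverage α (N i) ω ≤ B)
    (hS : ∀ i, S i ⊆ Finset.Icc 1 (N i)) (hS' : ∀ i, S' i ⊆ Finset.Icc 1 (N i))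
    (hd : Tendsto d atTop (𝓝 d₀))
    (hSS : Tendsto (fun i => ((symmDiff (S i) (S' i)).card : ℝ) / N i) atTop (𝓝 0)) {m : H}
    (hm : Tendsto (fun i => ‖(N i : ℝ)⁻¹ • ∑ t ∈ S' i, (K (M.shifted d₀ (N i) t ω) - m)‖ ^ 2) atTop
      (𝓝 0)) {v : ℝ}
    (hv : Tendsto (fun i => ((S' i).card : ℝ) / N i) atTop (𝓝 v)) :
    Tendsto (fun i => (N i : ℝ)⁻¹ • ∑ t ∈ S i, K (M.shifted (d i) (N i) t ω)) atTop
      (𝓝 (v • m)) :=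
  tendsto_average_of_perturbation hS hS' (M.tendsto_average_sq_norm_sub hα hK hB hS hd)
    (M.average_sq_norm_shifted_le_of_le hα hK0 hK hB) hSS hm hv

theorem tendsto_sum_sq_norm_shifted (hα : 0 < α) (hK0 : K 0 = 0)
    (hK : ∀ x y, ‖K x - K y‖ ^ 2 = ‖x - y‖ ^ α) (hN : Tendsto N atTop atTop)
    (hB : ∀ i, M.sizeAverage α (N i) ω ≤ B) (hS : ∀ i, S i ⊆ Finset.Icc 1 (N i))
    (hd : Tendsto d atTop (𝓝 d₀)) :
    Tendsto (fun i => (∑ t ∈ S i, ‖K (M.shifted (d i) (N i) t ω)‖ ^ 2) / (N i : ℝ) ^ 2) atTop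
      (𝓝 0) :=
  tendsto_sum_sq_norm_div_sq hN hS (M.tendsto_average_sq_norm_sub hα hK hB hS hd)
    (M.average_sq_norm_shifted_le_of_le hα hK0 hK hB)

end PathwiseLimits

/-! ### Laws of the shifted disturbances and the law of large numbers within a regime -/

section Laws

variable {M}

/-- Each `lawX k` is thus the law of an actual regressor, hence a probability measure with the
required moments. -/
lemma exists_mem_segment (hlam0 : M.lam0 ∈ Set.Ioo (0 : ℝ) 1) (k : Fin 2) :
    ∃ T t, t ∈ segment T (M.T0 T) k := by
  obtain ⟨T, hT⟩ := exists_nat_gt (1 / M.lam0)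
  have hT1 : 1 < T * M.lam0 := by rwa [div_lt_iff₀ hlam0.1] at hT
  have hTpos : (0 : ℝ) < T := (one_div_pos.2 hlam0.1).trans hT
  fin_cases k
  · refine ⟨T, 1, mem_segment_zero.2 ⟨le_rfl, ?_⟩⟩
    exact Nat.le_floor (by push_cast; exact hT1.le)
  · refine ⟨T, T, mem_segment_one.2 ⟨?_, le_rfl⟩⟩
    rw [Nat.succ_le_iff, T0, Nat.floor_lt (by linarith)]
    nlinarith [hlam0.2]

lemma mem_Icc_of_mem_segment (hlam0 : M.lam0 ∈ Set.Ioo (0 : ℝ) 1) {T t : ℕ} {k : Fin 2}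
    (ht : t ∈ segment T (M.T0 T) k) : t ∈ Finset.Icc 1 T :=
  segment_subset_Icc (M.T0_le hlam0.2.le T) k ht

lemma isProbabilityMeasure_shiftedLaw [IsProbabilityMeasure M.lawU] (k : Fin 2)
    [IsProbabilityMeasure (M.lawX k)] (d : Coef p q) : IsProbabilityMeasure (M.shiftedLaw k d) := by
  have : IsProbabilityMeasure ((M.lawX k).map fun x => fit x d) :=
    Measure.isProbabilityMeasure_map (continuous_fit d).measurable.aemeasurable
  unfold shiftedLaw
  infer_instance

/-- For two independent copies the covariance vanishes, so the mean squared distance of the embedded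
copies is twice the variance. -/
lemma limitY_eq {α : ℝ} {H : Type*} [NormedAddCommGroup H] [InnerProductSpace ℝ H] [CompleteSpace H]
    {K : Vec q → H} (hα : 0 < α) (hK : ∀ x y, ‖K x - K y‖ ^ 2 = ‖x - y‖ ^ α)
    (k : Fin 2) [IsProbabilityMeasure M.lawU] [IsProbabilityMeasure (M.lawX k)] (d : Coef p q)
    (hL2 : MemLp K 2 (M.shiftedLaw k d)) :
    M.limitY α k d d = 2 * (∫ r, ‖K r‖ ^ 2 ∂(M.shiftedLaw k d) -
      ‖∫ r, K r ∂(M.shiftedLaw k d)‖ ^ 2) := by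
  have hKc := continuous_embedding hα hK
  have hKsq : ∀ ρ : Measure (Vec q), AEStronglyMeasurable (fun r => ‖K r‖ ^ 2) ρ := fun ρ =>
    (hKc.norm.pow 2).aestronglyMeasurable
  have hfit : Measurable fun z : Vec q × Vec p => z.1 + fit z.2 d :=
    measurable_fst.add ((continuous_fit d).measurable.comp measurable_snd)
  set ν := M.lawU.prod (M.lawX k) with hν
  have hlaw : ν.map (fun z => z.1 + fit z.2 d) = M.shiftedLaw k d := by
    have hind : IndepFun (fun z : Vec q × Vec p => z.1) (fun z => fit z.2 d) ν :=
      indepFun_prod measurable_id (continuous_fit d).measurable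
    have h := hind.map_add_eq_map_conv_map measurable_fst
      ((continuous_fit d).measurable.comp measurable_snd)
    have h1 : ν.map (fun z : Vec q × Vec p => z.1) = M.lawU := measurePreserving_fst.map_eq
    have h2 : ν.map (fun z : Vec q × Vec p => fit z.2 d) = (M.lawX k).map fun x => fit x d := by
      rw [← (measurePreserving_snd (μ := M.lawU) (ν := M.lawX k)).map_eq,
        Measure.map_map (continuous_fit d).measurable measurable_snd]
      rfl
    have h3 : ν.map (fun z => z.1 + fit z.2 d) = (ν.map fun z : Vec q × Vec p => z.1).conv
        (ν.map fun z : Vec q × Vec p => fit z.2 d) := h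
    rw [h3, h1, h2, shiftedLaw]
  set f : Vec q × Vec p → H := fun z => K (z.1 + fit z.2 d) with hf
  have hfL2 : MemLp f 2 ν := by
    rw [← hlaw, memLp_map_measure_iff hKc.aestronglyMeasurable hfit.aemeasurable] at hL2
    exact hL2
  have hfm : ∫ z, f z ∂ν = ∫ r, K r ∂(M.shiftedLaw k d) := by
    rw [← hlaw, integral_map hfit.aemeasurable hKc.aestronglyMeasurable]
  have hfs : ∫ z, ‖f z‖ ^ 2 ∂ν = ∫ r, ‖K r‖ ^ 2 ∂(M.shiftedLaw k d) := by
    rw [← hlaw, integral_map hfit.aemeasurable (hKsq _)]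
  set m := ∫ r, K r ∂(M.shiftedLaw k d) with hm
  have hY : M.limitY α k d d = ∫ w, ‖f w.1 - f w.2‖ ^ 2 ∂(ν.prod ν) := by
    have hFmeas : Measurable fun w : (Vec q × Vec p) × (Vec q × Vec p) => ‖f w.1 - f w.2‖ ^ 2 := by
      have : ∀ w : (Vec q × Vec p) × (Vec q × Vec p), ‖f w.1 - f w.2‖ ^ 2 =
          ‖(w.1.1 + fit w.1.2 d) - (w.2.1 + fit w.2.2 d)‖ ^ α := fun w => hK _ _
      simp_rw [this]
      exact (((hfit.comp measurable_fst).sub (hfit.comp measurable_snd)).norm).pow_const α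
    rw [hν, ← map_prod_rearrange, integral_map (by fun_prop) hFmeas.aestronglyMeasurable]
    unfold limitY
    refine integral_congr_ae (Eventually.of_forall fun z => ?_)
    simp only [hf, hK]
    congr 2
    abel
  have hL1 : MemLp (fun w : (Vec q × Vec p) × (Vec q × Vec p) => f w.1) 2 (ν.prod ν) :=
    hfL2.comp_measurePreserving measurePreserving_fst
  have hL2' : MemLp (fun w : (Vec q × Vec p) × (Vec q × Vec p) => f w.2) 2 (ν.prod ν) :=
    hfL2.comp_measurePreserving measurePreserving_snd
  have e1 : ∫ w, f w.1 ∂(ν.prod ν) = m := by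
    rw [integral_fun_fst]
    simpa using hfm
  have e2 : ∫ w, f w.2 ∂(ν.prod ν) = m := by
    rw [integral_fun_snd]
    simpa using hfm
  have s1 : ∫ w, ‖f w.1‖ ^ 2 ∂(ν.prod ν) = ∫ r, ‖K r‖ ^ 2 ∂(M.shiftedLaw k d) := by
    rw [integral_fun_fst fun z => ‖f z‖ ^ 2]
    simpa using hfs
  have s2 : ∫ w, ‖f w.2‖ ^ 2 ∂(ν.prod ν) = ∫ r, ‖K r‖ ^ 2 ∂(M.shiftedLaw k d) := by
    rw [integral_fun_snd fun z => ‖f z‖ ^ 2]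
    simpa using hfs
  have hcov := integral_inner_sub_mean hL1 hL2' e1 e2 s1 s2
  have hzero : ∫ w : (Vec q × Vec p) × (Vec q × Vec p),
      inner ℝ (f w.1 - m) (f w.2 - m) ∂(ν.prod ν) = 0 := by
    have hfi : Integrable f ν := hfL2.integrable (by norm_num)
    have hc : ∫ z, (f z - m) ∂ν = 0 := by
      rw [integral_sub hfi (integrable_const m), hfm]
      simp
    have hi : Integrable (fun w : (Vec q × Vec p) × (Vec q × Vec p) =>
        inner ℝ (f w.1 - m) (f w.2 - m)) (ν.prod ν) :=
      integrable_inner_of_memLp_two (hL1.sub (memLp_const m)) (hL2'.sub (memLp_const m))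
    rw [integral_prod _ hi]
    have : ∀ z, ∫ z', inner ℝ (f z - m) (f z' - m) ∂ν = 0 := fun z => by
      rw [integral_inner (f := fun z' => f z' - m) (hfi.sub (integrable_const m)), hc,
        inner_zero_right]
    simp only [this, integral_zero]
  rw [hzero, ← hY] at hcov
  linarith

variable [MeasurableSpace Ω] {P : Measure Ω} {α : ℝ}

lemma measurable_shifted (hx : M.RegressorAssumption P α) (hu : M.DisturbanceAssumption P α)
    (d : Coef p q) (T t : ℕ) : Measurable (M.shifted d T t) :=
  (hu.measurable t).add ((continuous_fit d).measurable.comp (hx.measurable T t))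

lemma measurable_sizeAverage (hx : M.RegressorAssumption P α) (hu : M.DisturbanceAssumption P α)
    (T : ℕ) : Measurable (M.sizeAverage α T) := by
  unfold sizeAverage
  refine (Finset.measurable_fun_sum _ fun t _ => ?_).const_mul _
  exact (((hu.measurable t).norm.pow_const α).const_add 1).add
    ((hx.measurable T t).norm.pow_const α)

variable [IsProbabilityMeasure P]

lemma DisturbanceAssumption.isProbabilityMeasure (hu : M.DisturbanceAssumption P α) :
    IsProbabilityMeasure M.lawU := by
  rw [← hu.law 0]
  exact Measure.isProbabilityMeasure_map (hu.measurable 0).aemeasurable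

lemma RegressorAssumption.isProbabilityMeasure (hx : M.RegressorAssumption P α)
    (hlam0 : M.lam0 ∈ Set.Ioo (0 : ℝ) 1) (k : Fin 2) : IsProbabilityMeasure (M.lawX k) := by
  obtain ⟨T, t, ht⟩ := exists_mem_segment hlam0 k
  rw [← hx.law T k t ht]
  exact Measure.isProbabilityMeasure_map (hx.measurable T t).aemeasurable

lemma map_shifted (hx : M.RegressorAssumption P α) (hu : M.DisturbanceAssumption P α)
    (hlam0 : M.lam0 ∈ Set.Ioo (0 : ℝ) 1) (d : Coef p q) {T t : ℕ} {k : Fin 2}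
    (ht : t ∈ segment T (M.T0 T) k) : P.map (M.shifted d T t) = M.shiftedLaw k d := by
  have hind : IndepFun (M.u t) (fun ω => fit (M.x T t ω) d) P :=
    (hu.indep_regressor T t t (mem_Icc_of_mem_segment hlam0 ht)).comp measurable_id
      (continuous_fit d).measurable
  have h := hind.map_add_eq_map_conv_map (hu.measurable t)
    ((continuous_fit d).measurable.comp (hx.measurable T t))
  rw [shiftedLaw, ← hu.law t, ← hx.law T k t ht,
    Measure.map_map (continuous_fit d).measurable (hx.measurable T t)]
  exact h

lemma integrable_norm_u_rpow (hu : M.DisturbanceAssumption P α) (t : ℕ) :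
    Integrable (fun ω => ‖M.u t ω‖ ^ α) P :=
  integrable_norm_rpow_of_two_mul (hu.measurable t).aestronglyMeasurable (hu.moment t)

lemma integrable_norm_x_rpow (hx : M.RegressorAssumption P α) {T t : ℕ}
    (ht : t ∈ Finset.Icc 1 T) : Integrable (fun ω => ‖M.x T t ω‖ ^ α) P :=
  integrable_norm_rpow_of_two_mul (hx.measurable T t).aestronglyMeasurable (hx.moment T t ht)

variable {H : Type*} [NormedAddCommGroup H] {K : Vec q → H}

lemma memLp_embedding_shifted (hα : 0 < α) (hK0 : K 0 = 0)
    (hK : ∀ x y, ‖K x - K y‖ ^ 2 = ‖x - y‖ ^ α)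
    (hx : M.RegressorAssumption P α) (hu : M.DisturbanceAssumption P α)
    (d : Coef p q) {T t : ℕ} (ht : t ∈ Finset.Icc 1 T) :
    MemLp (fun ω => K (M.shifted d T t ω)) 2 P := by
  have hmeas : AEStronglyMeasurable (fun ω => K (M.shifted d T t ω)) P :=
    (continuous_embedding hα hK).stronglyMeasurable.comp_measurable
      (measurable_shifted hx hu d T t) |>.aestronglyMeasurable
  rw [memLp_two_iff_integrable_sq_norm hmeas]
  refine ((((integrable_const 1).add (integrable_norm_u_rpow hu t)).add
    (integrable_norm_x_rpow hx ht)).const_mul (growthConst α d)).mono' (hmeas.norm.pow 2)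
    (Eventually.of_forall fun ω => ?_)
  rw [Real.norm_of_nonneg (sq_nonneg _), sq_norm_embedding hK0 hK]
  exact norm_add_fit_rpow_le hα.le _ _ _

lemma memLp_embedding_shiftedLaw (hα : 0 < α) (hK0 : K 0 = 0)
    (hK : ∀ x y, ‖K x - K y‖ ^ 2 = ‖x - y‖ ^ α)
    (hx : M.RegressorAssumption P α) (hu : M.DisturbanceAssumption P α)
    (hlam0 : M.lam0 ∈ Set.Ioo (0 : ℝ) 1) (k : Fin 2) (d : Coef p q) :
    MemLp K 2 (M.shiftedLaw k d) := by
  obtain ⟨T, t, ht⟩ := exists_mem_segment hlam0 k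
  rw [← map_shifted hx hu hlam0 d ht,
    memLp_map_measure_iff (continuous_embedding hα hK).aestronglyMeasurable
      (measurable_shifted hx hu d T t).aemeasurable]
  exact memLp_embedding_shifted hα hK0 hK hx hu d (mem_Icc_of_mem_segment hlam0 ht)

lemma lintegral_sizeAverage_le (hx : M.RegressorAssumption P α)
    (hu : M.DisturbanceAssumption P α) :
    ∃ C : ℝ, ∀ T, ∫⁻ ω, ENNReal.ofReal (M.sizeAverage α T ω) ∂P ≤ ENNReal.ofReal C := by
  have hpow : ∀ n : ℕ, Measurable fun z : Vec n => ‖z‖ ^ α := fun n => by fun_prop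
  set CU := ∫ z, ‖z‖ ^ α ∂M.lawU with hCU
  set CX := fun k => ∫ z, ‖z‖ ^ α ∂(M.lawX k) with hCX
  have hCU0 : 0 ≤ CU := integral_nonneg fun z => Real.rpow_nonneg (norm_nonneg _) _
  have hCX0 : ∀ k, 0 ≤ CX k := fun k => integral_nonneg fun z => Real.rpow_nonneg (norm_nonneg _) _
  have hinteg : ∀ T, ∀ t ∈ Finset.Icc 1 T,
      Integrable (fun ω => 1 + ‖M.u t ω‖ ^ α + ‖M.x T t ω‖ ^ α) P := fun T t ht =>
    ((integrable_const 1).add (integrable_norm_u_rpow hu t)).add (integrable_norm_x_rpow hx ht)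
  -- `CX 0 + CX 1` bounds the regressor moment in either regime.
  have hterm : ∀ T, ∀ t ∈ Finset.Icc 1 T,
      ∫ ω, (1 + ‖M.u t ω‖ ^ α + ‖M.x T t ω‖ ^ α) ∂P ≤ 1 + CU + (CX 0 + CX 1) := by
    intro T t ht
    have e1 : ∫ ω, ‖M.u t ω‖ ^ α ∂P = CU := by
      rw [hCU, ← hu.law t, integral_map (hu.measurable t).aemeasurable
        (hpow q).aestronglyMeasurable]
    have e2 : ∀ k, t ∈ segment T (M.T0 T) k → ∫ ω, ‖M.x T t ω‖ ^ α ∂P = CX k := by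
      intro k hk
      simp only [hCX]
      rw [← hx.law T k t hk, integral_map (hx.measurable T t).aemeasurable
        (hpow p).aestronglyMeasurable]
    have e3 : ∫ ω, ‖M.x T t ω‖ ^ α ∂P ≤ CX 0 + CX 1 := by
      rw [Finset.mem_Icc] at ht
      rcases le_or_gt t (M.T0 T) with h | h
      · rw [e2 0 (mem_segment_zero.2 ⟨ht.1, h⟩)]
        linarith [hCX0 1]
      · rw [e2 1 (mem_segment_one.2 ⟨h, ht.2⟩)]
        linarith [hCX0 0]
    have e4 : ∫ ω, (1 + ‖M.u t ω‖ ^ α + ‖M.x T t ω‖ ^ α) ∂P =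
        ∫ ω, (1 + ‖M.u t ω‖ ^ α) ∂P + ∫ ω, ‖M.x T t ω‖ ^ α ∂P :=
      integral_add ((integrable_const 1).add (integrable_norm_u_rpow hu t))
        (integrable_norm_x_rpow hx ht)
    rw [e4, integral_add (integrable_const 1) (integrable_norm_u_rpow hu t), e1]
    simp only [integral_const, probReal_univ, smul_eq_mul, mul_one]
    linarith
  refine ⟨1 + CU + (CX 0 + CX 1), fun T => ?_⟩
  have hWint : Integrable (M.sizeAverage α T) P :=
    (integrable_finsetSum _ (hinteg T)).const_mul _
  rw [← ofReal_integral_eq_lintegral_ofReal hWint (Eventually.of_forall fun ω => by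
    unfold sizeAverage
    simp only [Pi.zero_apply]
    positivity)]
  refine ENNReal.ofReal_le_ofReal ?_
  unfold sizeAverage
  rw [integral_const_mul, integral_finsetSum _ (hinteg T)]
  have h1 := Finset.sum_le_sum (hterm T)
  rw [Finset.sum_const, Nat.card_Icc, Nat.add_sub_cancel, nsmul_eq_mul] at h1
  refine (mul_le_mul_of_nonneg_left h1 (by positivity)).trans ?_
  rw [← mul_assoc]
  refine mul_le_of_le_one_left (by linarith [hCX0 0, hCX0 1]) ?_
  exact inv_mul_le_one

variable [InnerProductSpace ℝ H] [CompleteSpace H]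

/-- The mean condition on `Y` with equal coefficients, rewritten by `limitY_eq`, is exactly the
decorrelation hypothesis of the Hilbert space law of large numbers. -/
theorem tendstoInMeasure_regime_average (hα : 0 < α) (hK0 : K 0 = 0)
    (hK : ∀ x y, ‖K x - K y‖ ^ 2 = ‖x - y‖ ^ α)
    (hx : M.RegressorAssumption P α) (hu : M.DisturbanceAssumption P α)
    (hY : M.AsymptoticIndependence P α) (hlam0 : M.lam0 ∈ Set.Ioo (0 : ℝ) 1) (k : Fin 2)
    (d : Coef p q) {S : ℕ → Finset ℕ} (hS : ∀ T, S T ⊆ segment T (M.T0 T) k) :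
    TendstoInMeasure P (fun (T : ℕ) ω => ‖(T : ℝ)⁻¹ • ∑ t ∈ S T,
      (K (M.shifted d T t ω) - ∫ r, K r ∂(M.shiftedLaw k d))‖ ^ 2) atTop (fun _ => 0) := by
  have := hu.isProbabilityMeasure
  have := hx.isProbabilityMeasure hlam0 k
  have hKc := continuous_embedding hα hK
  have hKsq : ∀ ρ : Measure (Vec q), AEStronglyMeasurable (fun r => ‖K r‖ ^ 2) ρ := fun ρ =>
    (hKc.norm.pow 2).aestronglyMeasurable
  have hIcc : ∀ T, S T ⊆ Finset.Icc 1 T := fun T t ht => mem_Icc_of_mem_segment hlam0 (hS T ht)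
  refine tendstoInMeasure_sq_norm_average (fun T t ω => K (M.shifted d T t ω)) S hIcc _
    (∫ r, ‖K r‖ ^ 2 ∂(M.shiftedLaw k d))
    (fun T t ht => memLp_embedding_shifted hα hK0 hK hx hu d (hIcc T ht)) (fun T t ht => ?_)
    (fun T t ht => ?_) fun η hη => ?_
  · rw [← map_shifted hx hu hlam0 d (hS T ht), integral_map
      (measurable_shifted hx hu d T t).aemeasurable hKc.aestronglyMeasurable]
  · rw [← map_shifted hx hu hlam0 d (hS T ht), integral_map
      (measurable_shifted hx hu d T t).aemeasurable (hKsq _)]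
  · obtain ⟨N, hN⟩ := hY.mean k d d η hη
    refine ⟨N, fun T i hi j hj hij => ?_⟩
    have h := hN T i (hS T hi) j (hS T hj) hij
    rw [limitY_eq hα hK k d (memLp_embedding_shiftedLaw hα hK0 hK hx hu hlam0 k d)] at h
    have e : ∀ ω, ‖K (M.shifted d T i ω) - K (M.shifted d T j ω)‖ ^ 2 = M.Y α T d d i j ω := by
      intro ω
      rw [hK, Y, shifted, shifted]
      congr 2
      abel
    simp_rw [e]
    exact h

end Laws

end Model

namespace Model

variable {Ω : Type*} {p q : ℕ} (M : Model Ω p q)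

/-! ### Comparing the objective at two change points -/

section Objective

variable {α : ℝ} {H : Type*} [NormedAddCommGroup H] [InnerProductSpace ℝ H] {K : Vec q → H}
  (bhat : ℕ → ℕ → Ω → Fin 2 → Coef p q)

lemma objective_div_eq {T τ : ℕ} (ω : Ω) (h : 2 ≤ (segment T τ 0).card) :
    M.objective α bhat T ω τ / T = ((segment T τ 0).card / T : ℝ) * ((segment T τ 1).card / T) *
      ((2 * meanCross α (M.residual T τ ω (bhat T τ ω)) (segment T τ 0) (segment T τ 1) -
        meanWithin α (M.residual T τ ω (bhat T τ ω)) (segment T τ 0) -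
        meanWithin α (M.residual T τ ω (bhat T τ ω)) (segment T τ 1)) / 2) := by
  have h2 : (2 : ℝ) ≤ (segment T τ 0).card := by exact_mod_cast h
  have h3 : ((segment T τ 0).card : ℝ) + ((segment T τ 1).card : ℝ) ≠ 0 := by positivity
  unfold objective energyDist
  rcases eq_or_ne (T : ℝ) 0 with hT | hT
  · simp [hT]
  · field_simp

/-- The average of the embedded residuals over a segment. -/
def segAverage (K : Vec q → H) (T τ : ℕ) (ω : Ω) (k : Fin 2) : H :=
  ((segment T τ k).card : ℝ)⁻¹ • ∑ t ∈ segment T τ k, K (M.residual T τ ω (bhat T τ ω) t)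

lemma objective_div_le (hα : α ≠ 0) (hK : ∀ x y, ‖K x - K y‖ ^ 2 = ‖x - y‖ ^ α) {T τ : ℕ} (ω : Ω)
    (h : ∀ k, 2 ≤ (segment T τ k).card) :
    M.objective α bhat T ω τ / T ≤ ((segment T τ 0).card / T : ℝ) * ((segment T τ 1).card / T) *
      ‖M.segAverage bhat K T τ ω 0 - M.segAverage bhat K T τ ω 1‖ ^ 2 := by
  rw [M.objective_div_eq bhat ω (h 0)]
  refine mul_le_mul_of_nonneg_left ?_ (by positivity)
  have := energy_le hα hK (M.residual T τ ω (bhat T τ ω)) (h 0) (h 1)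
  unfold segAverage
  linarith

lemma le_objective_div (hα : α ≠ 0) (hK : ∀ x y, ‖K x - K y‖ ^ 2 = ‖x - y‖ ^ α) {T τ : ℕ} (ω : Ω)
    (h : ∀ k, 2 ≤ (segment T τ k).card) :
    ((segment T τ 0).card / T : ℝ) * ((segment T τ 1).card / T) *
      (‖M.segAverage bhat K T τ ω 0 - M.segAverage bhat K T τ ω 1‖ ^ 2 -
        2 * ((∑ t ∈ segment T τ 0, ‖K (M.residual T τ ω (bhat T τ ω) t)‖ ^ 2) /
          ((segment T τ 0).card : ℝ) ^ 2) -
        2 * ((∑ t ∈ segment T τ 1, ‖K (M.residual T τ ω (bhat T τ ω) t)‖ ^ 2) /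
          ((segment T τ 1).card : ℝ) ^ 2)) ≤ M.objective α bhat T ω τ / T := by
  rw [M.objective_div_eq bhat ω (h 0)]
  refine mul_le_mul_of_nonneg_left ?_ (by positivity)
  have := le_energy hα hK (M.residual T τ ω (bhat T τ ω)) (h 0) (h 1)
  unfold segAverage
  linarith

lemma sum_residual_eq {G : Type*} [AddCommMonoid G] (g : Vec q → G) {T τ : ℕ} {j k : Fin 2}
    {S : Finset ℕ} (hk : S ⊆ segment T (M.T0 T) k) (hj : S ⊆ segment T τ j) (ω : Ω)
    (b : Fin 2 → Coef p q) :
    ∑ t ∈ S, g (M.residual T τ ω b t) = ∑ t ∈ S, g (M.shifted (M.beta0 k - b j) T t ω) :=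
  Finset.sum_congr rfl fun t ht => by rw [M.residual_eq_shifted (hk ht) (hj ht)]

lemma sum_residual_eq_add {G : Type*} [AddCommMonoid G] (g : Vec q → G) {T τ : ℕ} {j j' : Fin 2}
    (hj : j ≠ j') (hτ : τ ≤ T) (hT0 : M.T0 T ≤ T)
    (h : segment T τ j ⊆ segment T (M.T0 T) j) (ω : Ω) (b : Fin 2 → Coef p q) :
    ∑ t ∈ segment T τ j', g (M.residual T τ ω b t) =
      ∑ t ∈ segment T (M.T0 T) j \ segment T τ j, g (M.shifted (M.beta0 j - b j') T t ω) +
      ∑ t ∈ segment T (M.T0 T) j', g (M.shifted (M.beta0 j' - b j') T t ω) := by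
  have hu := segment_eq_union hj hτ hT0 h
  have hd : Disjoint (segment T (M.T0 T) j \ segment T τ j) (segment T (M.T0 T) j') :=
    Finset.disjoint_of_subset_left Finset.sdiff_subset (disjoint_segment hj)
  rw [← M.sum_residual_eq (τ := τ) g (j := j') (k := j) Finset.sdiff_subset
      (hu ▸ Finset.subset_union_left) ω b,
    ← M.sum_residual_eq (τ := τ) g (j := j') (k := j') (Finset.Subset.refl _)
      (hu ▸ Finset.subset_union_right) ω b, ← Finset.sum_union hd, ← hu]

variable {N τ τ₀ : ℕ → ℕ} {ω : Ω}

lemma tendsto_segAverage (hN : Tendsto N atTop atTop) {k : Fin 2} {v : ℝ} (hv : v ≠ 0) {s : H}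
    (hcard : Tendsto (fun i => ((segment (N i) (τ i) k).card : ℝ) / N i) atTop (𝓝 v))
    (hsum : Tendsto (fun i => (N i : ℝ)⁻¹ • ∑ t ∈ segment (N i) (τ i) k,
      K (M.residual (N i) (τ i) ω (bhat (N i) (τ i) ω) t)) atTop (𝓝 s)) :
    Tendsto (fun i => M.segAverage bhat K (N i) (τ i) ω k) atTop (𝓝 (v⁻¹ • s)) := by
  refine ((hcard.inv₀ hv).smul hsum).congr' ?_
  filter_upwards [hN.eventually_ge_atTop 1] with i hi
  have hi' : (N i : ℝ) ≠ 0 := by exact_mod_cast (by omega : N i ≠ 0)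
  rw [segAverage, smul_smul]
  congr 1
  rw [inv_div]
  field_simp

lemma eventually_two_le_card (hN : Tendsto N atTop atTop) {v : ℝ} (hv : 0 < v) {A : ℕ → Finset ℕ}
    (hcard : Tendsto (fun i => ((A i).card : ℝ) / N i) atTop (𝓝 v)) :
    ∀ᶠ i in atTop, 2 ≤ (A i).card := by
  have h1 : Tendsto (fun i => ((A i).card : ℝ) / N i * N i) atTop atTop :=
    hcard.pos_mul_atTop hv (tendsto_natCast_atTop_atTop.comp hN)
  filter_upwards [h1.eventually_ge_atTop 2, hN.eventually_ge_atTop 1] with i hi hi1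
  have hi' : (N i : ℝ) ≠ 0 := by exact_mod_cast (by omega : N i ≠ 0)
  rw [div_mul_cancel₀ _ hi'] at hi
  exact_mod_cast hi

/-- Squeeze: `le_objective_div` at `τ`, the comparison with `τ₀`, then `objective_div_le` at `τ₀`,
where both averages tend to `m₀`. Positive segment fractions make the squared distance in the limit
vanish. -/
theorem limit_averages_eq (hα : α ≠ 0) (hK : ∀ x y, ‖K x - K y‖ ^ 2 = ‖x - y‖ ^ α)
    (hN : Tendsto N atTop atTop)
    (hobj : ∀ᶠ i in atTop,
      M.objective α bhat (N i) ω (τ i) ≤ M.objective α bhat (N i) ω (τ₀ i))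
    {v v₀ : Fin 2 → ℝ} (hv : ∀ k, 0 < v k) (hv₀ : ∀ k, 0 < v₀ k)
    (hcard : ∀ k, Tendsto (fun i => ((segment (N i) (τ i) k).card : ℝ) / N i) atTop (𝓝 (v k)))
    (hcard₀ : ∀ k, Tendsto (fun i => ((segment (N i) (τ₀ i) k).card : ℝ) / N i) atTop (𝓝 (v₀ k)))
    {s : Fin 2 → H} {m₀ : H}
    (hsum : ∀ k, Tendsto (fun i => (N i : ℝ)⁻¹ • ∑ t ∈ segment (N i) (τ i) k,
      K (M.residual (N i) (τ i) ω (bhat (N i) (τ i) ω) t)) atTop (𝓝 (s k)))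
    (hsq : ∀ k, Tendsto (fun i => (∑ t ∈ segment (N i) (τ i) k,
      ‖K (M.residual (N i) (τ i) ω (bhat (N i) (τ i) ω) t)‖ ^ 2) / (N i : ℝ) ^ 2) atTop (𝓝 0))
    (hsum₀ : ∀ k, Tendsto (fun i => (N i : ℝ)⁻¹ • ∑ t ∈ segment (N i) (τ₀ i) k,
      K (M.residual (N i) (τ₀ i) ω (bhat (N i) (τ₀ i) ω) t)) atTop (𝓝 (v₀ k • m₀))) :
    (v 0)⁻¹ • s 0 = (v 1)⁻¹ • s 1 := by
  have havg := fun k => M.tendsto_segAverage bhat hN (hv k).ne' (hcard k) (hsum k)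
  have havg₀ : ∀ k, Tendsto (fun i => M.segAverage bhat K (N i) (τ₀ i) ω k) atTop (𝓝 m₀) := by
    intro k
    have := M.tendsto_segAverage bhat hN (hv₀ k).ne' (hcard₀ k) (hsum₀ k)
    rwa [inv_smul_smul₀ (hv₀ k).ne'] at this
  have hq : ∀ k, Tendsto (fun i => (∑ t ∈ segment (N i) (τ i) k,
      ‖K (M.residual (N i) (τ i) ω (bhat (N i) (τ i) ω) t)‖ ^ 2) /
        ((segment (N i) (τ i) k).card : ℝ) ^ 2) atTop (𝓝 0) := by
    intro k
    have h1 := (hsq k).div ((hcard k).pow 2) (pow_ne_zero 2 (hv k).ne')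
    rw [zero_div] at h1
    refine h1.congr' ?_
    filter_upwards [hN.eventually_ge_atTop 1] with i hi
    have hi' : (N i : ℝ) ≠ 0 := by exact_mod_cast (by omega : N i ≠ 0)
    simp only [Pi.div_apply]
    field_simp
  have hupper := ((hcard₀ 0).mul (hcard₀ 1)).mul (((havg₀ 0).sub (havg₀ 1)).norm.pow 2)
  have hlower := ((hcard 0).mul (hcard 1)).mul
    ((((((havg 0).sub (havg 1)).norm.pow 2).sub ((hq 0).const_mul 2))).sub ((hq 1).const_mul 2))
  have hle := le_of_tendsto_of_tendsto hlower hupper (by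
    have c := fun k => eventually_two_le_card hN (hv k) (hcard k)
    have c₀ := fun k => eventually_two_le_card hN (hv₀ k) (hcard₀ k)
    filter_upwards [hobj, eventually_all.2 c, eventually_all.2 c₀] with i hi h h₀
    exact (M.le_objective_div bhat hα hK ω h).trans
      ((div_le_div_of_nonneg_right hi (Nat.cast_nonneg _)).trans
        (M.objective_div_le bhat hα hK ω h₀)))
  simp only [sub_self, norm_zero, ne_eq, OfNat.ofNat_ne_zero, not_false_eq_true, zero_pow,
    mul_zero, sub_zero] at hle
  have hpos : 0 < v 0 * v 1 := mul_pos (hv 0) (hv 1)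
  have hz : ‖(v 0)⁻¹ • s 0 - (v 1)⁻¹ • s 1‖ ^ 2 ≤ 0 := by
    by_contra hcon
    exact absurd hle (not_le.2 (mul_pos hpos (not_le.1 hcon)))
  have hz' : ‖(v 0)⁻¹ • s 0 - (v 1)⁻¹ • s 1‖ = 0 := by
    have := sq_nonneg ‖(v 0)⁻¹ • s 0 - (v 1)⁻¹ • s 1‖
    exact pow_eq_zero_iff (two_ne_zero) |>.1 (le_antisymm hz this)
  exact sub_eq_zero.1 (norm_eq_zero.1 hz')

end Objective

lemma segFraction_pos {l : ℝ} (hl : l ∈ Set.Ioo (0 : ℝ) 1) (k : Fin 2) : 0 < segFraction l k := by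
  unfold segFraction
  split_ifs
  · exact hl.1
  · linarith [hl.2]

lemma segFraction_add {j j' : Fin 2} (hj : j ≠ j') (l : ℝ) :
    segFraction l j + segFraction l j' = 1 := by
  fin_cases j <;> fin_cases j' <;> simp [segFraction] at hj ⊢

lemma continuous_segFraction (k : Fin 2) : Continuous fun l => segFraction l k := by
  unfold segFraction
  split_ifs <;> fun_prop

lemma tendsto_card_segment_div {N τ : ℕ → ℕ} (hN : Tendsto N atTop atTop) (hτ : ∀ i, τ i ≤ N i)
    {l : ℝ} (h : Tendsto (fun i => (τ i : ℝ) / N i) atTop (𝓝 l)) (k : Fin 2) :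
    Tendsto (fun i => ((segment (N i) (τ i) k).card : ℝ) / N i) atTop (𝓝 (segFraction l k)) := by
  refine (((continuous_segFraction k).tendsto l).comp h).congr' ?_
  filter_upwards [hN.eventually_ge_atTop 1] with i hi
  exact (card_segment_div (by omega) (hτ i) k).symm

end Model

/-! ### The mixture identity and its contradiction with the change -/

namespace Model

variable {Ω : Type*} {p q : ℕ} {M : Model Ω p q} {α : ℝ} {H : Type*} [NormedAddCommGroup H]
  [InnerProductSpace ℝ H] {K : Vec q → H} {bhat : ℕ → ℕ → Ω → Fin 2 → Coef p q}
  {j j' : Fin 2} {l : ℝ} {c : Coef p q}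

/-- Along a path on which all estimators and averages converge, the embedded law of the
disturbances is the embedded mixture of the laws of the residuals. -/
theorem embedding_eq_mixture_of_path (hα : 0 < α) (hK0 : K 0 = 0)
    (hK : ∀ x y, ‖K x - K y‖ ^ 2 = ‖x - y‖ ^ α) (hlam0 : M.lam0 ∈ Set.Ioo (0 : ℝ) 1)
    (hj : j ≠ j') (hl : l ∈ Set.Ioo (0 : ℝ) 1)
    (hsubl : ∀ T : ℕ, segment T ⌊(T : ℝ) * l⌋₊ j ⊆ segment T (M.T0 T) j)
    {N τ : ℕ → ℕ} {ω : Ω} {B : ℝ} (hN : Tendsto N atTop atTop)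
    (hB : ∀ i, M.sizeAverage α (N i) ω ≤ B) (hτ : ∀ i, τ i ≤ N i)
    (hsub : ∀ i, segment (N i) (τ i) j ⊆ segment (N i) (M.T0 (N i)) j)
    (hτl : Tendsto (fun i => (τ i : ℝ) / N i) atTop (𝓝 l))
    (hobj : ∀ᶠ i in atTop,
      M.objective α bhat (N i) ω (τ i) ≤ M.objective α bhat (N i) ω (M.T0 (N i)))
    (hbj : Tendsto (fun i => bhat (N i) (τ i) ω j) atTop (𝓝 (M.beta0 j)))
    (hbj' : Tendsto (fun i => bhat (N i) (τ i) ω j') atTop (𝓝 c))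
    (hb0 : ∀ k, Tendsto (fun i => bhat (N i) (M.T0 (N i)) ω k) atTop (𝓝 (M.beta0 k)))
    {m : Fin 2 → Coef p q → H} {m₀ : H} (hm0 : ∀ k, m k 0 = m₀)
    (hfull : ∀ k, Tendsto (fun i => ‖(N i : ℝ)⁻¹ • ∑ t ∈ segment (N i) (M.T0 (N i)) k,
      (K (M.shifted 0 (N i) t ω) - m k 0)‖ ^ 2) atTop (𝓝 0))
    (hnear : Tendsto (fun i => ‖(N i : ℝ)⁻¹ • ∑ t ∈ segment (N i) ⌊(N i : ℝ) * l⌋₊ j,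
      (K (M.shifted 0 (N i) t ω) - m j 0)‖ ^ 2) atTop (𝓝 0))
    (hrest : Tendsto (fun i => ‖(N i : ℝ)⁻¹ •
      ∑ t ∈ segment (N i) (M.T0 (N i)) j \ segment (N i) ⌊(N i : ℝ) * l⌋₊ j,
      (K (M.shifted (M.beta0 j - c) (N i) t ω) - m j (M.beta0 j - c))‖ ^ 2) atTop (𝓝 0))
    (hfar : Tendsto (fun i => ‖(N i : ℝ)⁻¹ • ∑ t ∈ segment (N i) (M.T0 (N i)) j',
      (K (M.shifted (M.beta0 j' - c) (N i) t ω) - m j' (M.beta0 j' - c))‖ ^ 2) atTop (𝓝 0)) :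
    m₀ = (segFraction l j')⁻¹ •
      ((segFraction M.lam0 j - segFraction l j) • m j (M.beta0 j - c) +
        segFraction M.lam0 j' • m j' (M.beta0 j' - c)) := by
  have hT0 : ∀ T, M.T0 T ≤ T := M.T0_le hlam0.2.le
  have hfl : ∀ i, ⌊(N i : ℝ) * l⌋₊ ≤ N i := fun i =>
    Nat.floor_le_of_le (by nlinarith [Nat.cast_nonneg (α := ℝ) (N i), hl.2])
  have hIcc : ∀ k i, segment (N i) (M.T0 (N i)) k ⊆ Finset.Icc 1 (N i) := fun k i =>
    segment_subset_Icc (hT0 _) k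
  have hfllim : Tendsto (fun i => (⌊(N i : ℝ) * l⌋₊ : ℝ) / N i) atTop (𝓝 l) :=
    (tendsto_floor_mul_div hl.1.le).comp hN
  have hT0lim : Tendsto (fun i => (M.T0 (N i) : ℝ) / N i) atTop (𝓝 M.lam0) :=
    (tendsto_floor_mul_div hlam0.1.le).comp hN
  have hcard := fun k => tendsto_card_segment_div hN hτ hτl k
  have hcard₀ := fun k => tendsto_card_segment_div hN (fun i => hT0 (N i)) hT0lim k
  have hcardl := tendsto_card_segment_div hN hfl hfllim j
  have hself : ∀ A : ℕ → Finset ℕ,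
      Tendsto (fun i => ((symmDiff (A i) (A i)).card : ℝ) / N i) atTop (𝓝 0) := fun A => by simp
  -- The random `τ i` is replaced by the deterministic `⌊N i * l⌋₊`, to which the law of large
  -- numbers applies.
  have hdiff : Tendsto (fun i => ((symmDiff (segment (N i) (τ i) j)
      (segment (N i) ⌊(N i : ℝ) * l⌋₊ j)).card : ℝ) / N i) atTop (𝓝 0) := by
    have h1 := (hτl.sub hfllim).abs
    rw [sub_self, abs_zero] at h1
    refine squeeze_zero (fun i => by positivity) (fun i => ?_) h1
    rw [← sub_div, abs_div, Nat.abs_cast]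
    exact div_le_div_of_nonneg_right (card_symmDiff_segment_le _ _ _ _) (Nat.cast_nonneg _)
  have hdiff' : Tendsto (fun i => ((symmDiff
      (segment (N i) (M.T0 (N i)) j \ segment (N i) (τ i) j)
      (segment (N i) (M.T0 (N i)) j \ segment (N i) ⌊(N i : ℝ) * l⌋₊ j)).card : ℝ) / N i) atTop
      (𝓝 0) := by
    refine squeeze_zero (fun i => by positivity) (fun i => ?_) hdiff
    exact div_le_div_of_nonneg_right
      (by exact_mod_cast Finset.card_le_card (symmDiff_sdiff_subset _ _ _)) (Nat.cast_nonneg _)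
  have hcardrest : Tendsto (fun i => ((segment (N i) (M.T0 (N i)) j \
      segment (N i) ⌊(N i : ℝ) * l⌋₊ j).card : ℝ) / N i) atTop
      (𝓝 (segFraction M.lam0 j - segFraction l j)) := by
    refine ((hcard₀ j).sub hcardl).congr fun i => ?_
    rw [Finset.card_sdiff_of_subset (hsubl _), Nat.cast_sub (Finset.card_le_card (hsubl _)),
      sub_div]
  have hd0 : ∀ k, Tendsto (fun i => M.beta0 k - bhat (N i) (M.T0 (N i)) ω k) atTop (𝓝 0) :=
    fun k => by simpa using (hb0 k).const_sub (M.beta0 k)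
  have hdj : Tendsto (fun i => M.beta0 j - bhat (N i) (τ i) ω j) atTop (𝓝 0) := by
    simpa using hbj.const_sub (M.beta0 j)
  have hsdiffIcc : ∀ (A : ℕ → Finset ℕ) i,
      segment (N i) (M.T0 (N i)) j \ A i ⊆ Finset.Icc 1 (N i) := fun A i =>
    Finset.sdiff_subset.trans (hIcc j i)
  -- At the true change point the coefficient errors vanish, so both segments share the limit `m₀`.
  have hsum₀ : ∀ k, Tendsto (fun i => (N i : ℝ)⁻¹ • ∑ t ∈ segment (N i) (M.T0 (N i)) k,
      K (M.residual (N i) (M.T0 (N i)) ω (bhat (N i) (M.T0 (N i)) ω) t)) atTop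
      (𝓝 (segFraction M.lam0 k • m₀)) := by
    intro k
    simp_rw [M.sum_residual_eq K (Finset.Subset.refl _) (Finset.Subset.refl _)]
    rw [← hm0 k]
    exact M.tendsto_average_shifted hα hK0 hK hB (hIcc k) (hIcc k) (hd0 k) (hself _) (hfull k)
      (hcard₀ k)
  have hsumj : Tendsto (fun i => (N i : ℝ)⁻¹ • ∑ t ∈ segment (N i) (τ i) j,
      K (M.residual (N i) (τ i) ω (bhat (N i) (τ i) ω) t)) atTop (𝓝 (segFraction l j • m₀)) := by
    have h : ∀ i, ∑ t ∈ segment (N i) (τ i) j,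
        K (M.residual (N i) (τ i) ω (bhat (N i) (τ i) ω) t) = ∑ t ∈ segment (N i) (τ i) j,
        K (M.shifted (M.beta0 j - bhat (N i) (τ i) ω j) (N i) t ω) := fun i =>
      M.sum_residual_eq K (hsub i) (Finset.Subset.refl _) ω _
    simp_rw [h]
    rw [← hm0 j]
    exact M.tendsto_average_shifted hα hK0 hK hB (fun i => segment_subset_Icc (hτ i) j)
      (fun i => segment_subset_Icc (hfl i) j) hdj hdiff hnear hcardl
  have hsqj : Tendsto (fun i => (∑ t ∈ segment (N i) (τ i) j,
      ‖K (M.residual (N i) (τ i) ω (bhat (N i) (τ i) ω) t)‖ ^ 2) / (N i : ℝ) ^ 2) atTop (𝓝 0) := by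
    have h : ∀ i, ∑ t ∈ segment (N i) (τ i) j,
        ‖K (M.residual (N i) (τ i) ω (bhat (N i) (τ i) ω) t)‖ ^ 2 = ∑ t ∈ segment (N i) (τ i) j,
        ‖K (M.shifted (M.beta0 j - bhat (N i) (τ i) ω j) (N i) t ω)‖ ^ 2 := fun i =>
      M.sum_residual_eq (fun r => ‖K r‖ ^ 2) (hsub i) (Finset.Subset.refl _) ω _
    simp_rw [h]
    exact M.tendsto_sum_sq_norm_shifted hα hK0 hK hN hB (fun i => segment_subset_Icc (hτ i) j) hdj
  have hsumj' : Tendsto (fun i => (N i : ℝ)⁻¹ • ∑ t ∈ segment (N i) (τ i) j',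
      K (M.residual (N i) (τ i) ω (bhat (N i) (τ i) ω) t)) atTop
      (𝓝 ((segFraction M.lam0 j - segFraction l j) • m j (M.beta0 j - c) +
        segFraction M.lam0 j' • m j' (M.beta0 j' - c))) := by
    have h := fun i => M.sum_residual_eq_add K hj (hτ i) (hT0 _) (hsub i) ω (bhat (N i) (τ i) ω)
    simp_rw [h, smul_add]
    refine Tendsto.add ?_ ?_
    · exact M.tendsto_average_shifted hα hK0 hK hB (hsdiffIcc _) (hsdiffIcc _)
        (hbj'.const_sub _) hdiff' hrest hcardrest
    · exact M.tendsto_average_shifted hα hK0 hK hB (hIcc j') (hIcc j') (hbj'.const_sub _)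
        (hself _) hfar (hcard₀ j')
  have hsqj' : Tendsto (fun i => (∑ t ∈ segment (N i) (τ i) j',
      ‖K (M.residual (N i) (τ i) ω (bhat (N i) (τ i) ω) t)‖ ^ 2) / (N i : ℝ) ^ 2) atTop (𝓝 0) := by
    have h := fun i => M.sum_residual_eq_add (fun r => ‖K r‖ ^ 2) hj (hτ i) (hT0 _) (hsub i) ω
      (bhat (N i) (τ i) ω)
    simp_rw [h, add_div]
    rw [← add_zero (0 : ℝ)]
    refine Tendsto.add ?_ ?_
    · exact M.tendsto_sum_sq_norm_shifted hα hK0 hK hN hB (hsdiffIcc _) (hbj'.const_sub _)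
    · exact M.tendsto_sum_sq_norm_shifted hα hK0 hK hN hB (hIcc j') (hbj'.const_sub _)
  have hcases : ∀ k, k = j ∨ k = j' := fun k => by
    fin_cases j <;> fin_cases j' <;> fin_cases k <;> simp at hj ⊢
  set s' := (segFraction M.lam0 j - segFraction l j) • m j (M.beta0 j - c) +
        segFraction M.lam0 j' • m j' (M.beta0 j' - c) with hs'
  let s : Fin 2 → H := fun k => if k = j then segFraction l j • m₀ else s'
  have hsj : s j = segFraction l j • m₀ := if_pos rfl
  have hsj' : s j' = s' := if_neg hj.symm
  have hmain := M.limit_averages_eq bhat hα.ne' hK hN hobj (segFraction_pos hl)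
    (segFraction_pos hlam0) hcard hcard₀ (s := s)
    (fun k => by
      rcases hcases k with rfl | rfl
      · rw [hsj]; exact hsumj
      · rw [hsj']; exact hsumj')
    (fun k => by
      rcases hcases k with rfl | rfl
      · exact hsqj
      · exact hsqj') hsum₀
  have hmain' : (segFraction l j)⁻¹ • s j = (segFraction l j')⁻¹ • s j' := by
    fin_cases j <;> fin_cases j'
    · simp at hj
    · exact hmain
    · exact hmain.symm
    · simp at hj
  rwa [hsj, hsj', inv_smul_smul₀ (segFraction_pos hl j).ne'] at hmain'

lemma shiftedLaw_zero [IsProbabilityMeasure M.lawU] (k : Fin 2) [IsProbabilityMeasure (M.lawX k)] :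
    M.shiftedLaw k 0 = M.lawU := by
  simp only [shiftedLaw, fit_zero, Measure.map_const, measure_univ, one_smul]
  exact Measure.conv_dirac_zero _

variable [MeasurableSpace Ω] {P : Measure Ω} [IsProbabilityMeasure P]

/-- The conclusion does not involve `ω`, so one path with all convergences and a bounded size
average proves it; hence the path-dependent subsequence is harmless. -/
theorem embedding_eq_mixture [CompleteSpace H] (hα : 0 < α) (hK0 : K 0 = 0)
    (hK : ∀ x y, ‖K x - K y‖ ^ 2 = ‖x - y‖ ^ α) (hx : M.RegressorAssumption P α)
    (hu : M.DisturbanceAssumption P α) (hY : M.AsymptoticIndependence P α)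
    (hlam0 : M.lam0 ∈ Set.Ioo (0 : ℝ) 1) (hj : j ≠ j') (hl : l ∈ Set.Ioo (0 : ℝ) 1)
    (hsubl : ∀ T : ℕ, segment T ⌊(T : ℝ) * l⌋₊ j ⊆ segment T (M.T0 T) j)
    {τ : ℕ → Ω → ℕ} (hτ : ∀ᶠ T in atTop, ∀ ω, τ T ω ≤ T)
    (hsub : ∀ T ω, segment T (τ T ω) j ⊆ segment T (M.T0 T) j)
    (hτl : TendstoInMeasure P (fun T ω => (τ T ω : ℝ) / (T : ℝ)) atTop (fun _ => l))
    (hobj : ∀ᶠ T : ℕ in atTop, ∀ ω,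
      M.objective α bhat T ω (τ T ω) ≤ M.objective α bhat T ω (M.T0 T))
    (hbj : TendstoInMeasure P (fun T ω => bhat T (τ T ω) ω j) atTop (fun _ => M.beta0 j))
    (hbj' : TendstoInMeasure P (fun T ω => bhat T (τ T ω) ω j') atTop (fun _ => c))
    (hb0 : ∀ k, TendstoInMeasure P (fun T ω => bhat T (M.T0 T) ω k) atTop
      (fun _ => M.beta0 k)) :
    ∫ r, K r ∂M.lawU = (segFraction l j')⁻¹ •
      ((segFraction M.lam0 j - segFraction l j) • ∫ r, K r ∂(M.shiftedLaw j (M.beta0 j - c)) +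
        segFraction M.lam0 j' • ∫ r, K r ∂(M.shiftedLaw j' (M.beta0 j' - c))) := by
  have := hu.isProbabilityMeasure
  have := hx.isProbabilityMeasure hlam0
  have hreg := fun (k : Fin 2) (d : Coef p q) {S : ℕ → Finset ℕ}
    (hS : ∀ T, S T ⊆ segment T (M.T0 T) k) =>
    tendstoInMeasure_regime_average hα hK0 hK hx hu hY hlam0 k d hS
  obtain ⟨ns, hns, hae⟩ := exists_subseq_ae_tendsto (P := P)
    -- The entries are found by unification with the proofs below, whose order is that of `f1`, …,
    -- `f10`.
    [_, _, _, _, _, _, _, _, _, _]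
    (List.forall_mem_cons.2 ⟨tendstoInMeasure_dist hτl,
      List.forall_mem_cons.2 ⟨tendstoInMeasure_dist hbj,
      List.forall_mem_cons.2 ⟨tendstoInMeasure_dist hbj',
      List.forall_mem_cons.2 ⟨tendstoInMeasure_dist (hb0 0),
      List.forall_mem_cons.2 ⟨tendstoInMeasure_dist (hb0 1),
      List.forall_mem_cons.2 ⟨hreg 0 0 (S := fun T => segment T (M.T0 T) 0)
        fun T => Finset.Subset.refl _,
      List.forall_mem_cons.2 ⟨hreg 1 0 (S := fun T => segment T (M.T0 T) 1)
        fun T => Finset.Subset.refl _,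
      List.forall_mem_cons.2 ⟨hreg j 0 hsubl,
      List.forall_mem_cons.2 ⟨hreg j (M.beta0 j - c)
        (S := fun T => segment T (M.T0 T) j \ segment T ⌊(T : ℝ) * l⌋₊ j)
        fun T => Finset.sdiff_subset,
      List.forall_mem_cons.2 ⟨hreg j' (M.beta0 j' - c) (S := fun T => segment T (M.T0 T) j')
        fun T => Finset.Subset.refl _,
      by simp⟩⟩⟩⟩⟩⟩⟩⟩⟩⟩)
  obtain ⟨C, hC⟩ := lintegral_sizeAverage_le hx hu
  have hbdd := ae_exists_subseq_bounded (P := P) (W := fun i => M.sizeAverage α (ns i))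
    (fun i => measurable_sizeAverage hx hu _) fun i => hC (ns i)
  obtain ⟨T₁, hT₁⟩ := eventually_atTop.1 hτ
  obtain ⟨ω, hω, B, ms, hms, hB⟩ := (hae.and hbdd).exists
  simp only [List.forall_mem_cons] at hω
  obtain ⟨f1, f2, f3, f4, f5, f6, f7, f8, f9, f10, -⟩ := hω
  -- The shift by `T₁` makes the eventual bound `τ ≤ T` hold for every index.
  set N : ℕ → ℕ := fun i => ns (ms (i + T₁)) with hNdef
  have hmsT : Tendsto (fun i => ms (i + T₁)) atTop atTop :=
    hms.tendsto_atTop.comp (tendsto_add_atTop_nat T₁)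
  have hN : Tendsto N atTop atTop := hns.tendsto_atTop.comp hmsT
  have hNT : ∀ i, T₁ ≤ N i := fun i =>
    (Nat.le_add_left T₁ i).trans ((hms.id_le _).trans (hns.id_le _))
  have hτlim : Tendsto (fun i => (τ (N i) ω : ℝ) / N i) atTop (𝓝 l) :=
    tendsto_iff_dist_tendsto_zero.2 (f1.comp hmsT)
  refine embedding_eq_mixture_of_path (M := M) (bhat := bhat) (ω := ω)
    (m := fun k d => ∫ r, K r ∂(M.shiftedLaw k d)) hα hK0 hK hlam0 hj hl hsubl hN
    (fun i => hB (i + T₁)) (τ := fun i => τ (N i) ω) (fun i => hT₁ _ (hNT i) ω)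
    (fun i => hsub _ _) hτlim
    ((hN.eventually hobj).mono fun i hi => hi ω) (tendsto_iff_dist_tendsto_zero.2 (f2.comp hmsT))
    (tendsto_iff_dist_tendsto_zero.2 (f3.comp hmsT)) ?_ (fun k => by rw [shiftedLaw_zero]) ?_
    (f8.comp hmsT) (f9.comp hmsT) (f10.comp hmsT)
  · intro k
    fin_cases k
    · exact tendsto_iff_dist_tendsto_zero.2 (f4.comp hmsT)
    · exact tendsto_iff_dist_tendsto_zero.2 (f5.comp hmsT)
  · intro k
    fin_cases k
    · exact f6.comp hmsT
    · exact f7.comp hmsT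

/-- If the embedded law of the disturbances is a proper mixture of the embedded laws of the
residuals, then one coefficient matrix fits both regimes. -/
theorem not_structuralChange_of_mixture (hα : 0 < α) (hK0 : K 0 = 0)
    (hK : ∀ x y, ‖K x - K y‖ ^ 2 = ‖x - y‖ ^ α)
    (hKinj : ∀ ρ ρ' : Measure (Vec q), IsProbabilityMeasure ρ → IsProbabilityMeasure ρ' →
      Integrable K ρ → Integrable K ρ' → ∫ x, K x ∂ρ = ∫ x, K x ∂ρ' → ρ = ρ')
    (hx : M.RegressorAssumption P α) (hu : M.DisturbanceAssumption P α)
    (hlam0 : M.lam0 ∈ Set.Ioo (0 : ℝ) 1) (hj : j ≠ j') (hl : l ∈ Set.Ioo (0 : ℝ) 1)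
    (hlt : segFraction l j < segFraction M.lam0 j)
    (h : ∫ r, K r ∂M.lawU = (segFraction l j')⁻¹ •
      ((segFraction M.lam0 j - segFraction l j) • ∫ r, K r ∂(M.shiftedLaw j (M.beta0 j - c)) +
        segFraction M.lam0 j' • ∫ r, K r ∂(M.shiftedLaw j' (M.beta0 j' - c)))) :
    ¬ M.StructuralChange := by
  have := hu.isProbabilityMeasure
  have hX := hx.isProbabilityMeasure hlam0
  have hlj' := segFraction_pos hl j'
  set w := (segFraction l j')⁻¹ * (segFraction M.lam0 j - segFraction l j) with hw
  set w' := (segFraction l j')⁻¹ * segFraction M.lam0 j' with hw'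
  have hwpos : 0 < w := mul_pos (inv_pos.2 hlj') (sub_pos.2 hlt)
  have hwpos' : 0 < w' := mul_pos (inv_pos.2 hlj') (segFraction_pos hlam0 j')
  have hsum : w + w' = 1 := by
    rw [hw, hw', ← mul_add]
    have h1 := segFraction_add hj M.lam0
    have h2 := segFraction_add hj l
    rw [show segFraction M.lam0 j - segFraction l j + segFraction M.lam0 j' = segFraction l j' by
      linarith, inv_mul_cancel₀ hlj'.ne']
  set ν := fun k => (M.lawX k).map fun x => fit x (M.beta0 k - c) with hν
  have hνprob : ∀ k, IsProbabilityMeasure (ν k) := fun k =>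
    Measure.isProbabilityMeasure_map (continuous_fit _).measurable.aemeasurable
  -- Convolution is linear, so the mixture of the two residual laws is `M.lawU` convolved with this
  -- mixture of laws of fitted coefficient errors.
  set η := ENNReal.ofReal w • ν j + ENNReal.ofReal w' • ν j' with hη
  have hηprob : IsProbabilityMeasure η := ⟨by
    simp only [hη, Measure.coe_add, Measure.coe_smul, Pi.add_apply, Pi.smul_apply, measure_univ,
      smul_eq_mul, mul_one]
    rw [← ENNReal.ofReal_add hwpos.le hwpos'.le, hsum, ENNReal.ofReal_one]⟩
  have hsmul : ∀ k (a : ℝ), M.lawU.conv (ENNReal.ofReal a • ν k) =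
      ENNReal.ofReal a • M.shiftedLaw k (M.beta0 k - c) := by
    intro k a
    rw [Measure.conv_comm, Measure.conv_smul_left, Measure.conv_comm, shiftedLaw]
  have hconv : M.lawU.conv η = ENNReal.ofReal w • M.shiftedLaw j (M.beta0 j - c) +
      ENNReal.ofReal w' • M.shiftedLaw j' (M.beta0 j' - c) := by
    rw [hη, Measure.conv_add, hsmul, hsmul]
  have hinteg : ∀ k d, Integrable K (M.shiftedLaw k d) := fun k d => by
    have := isProbabilityMeasure_shiftedLaw (M := M) k d
    exact (memLp_embedding_shiftedLaw hα hK0 hK hx hu hlam0 k d).integrable (by norm_num)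
  have hint1 := fun (k : Fin 2) (a : ℝ) =>
    (hinteg k (M.beta0 k - c)).smul_measure (c := ENNReal.ofReal a) ENNReal.ofReal_ne_top
  have hU : Integrable K M.lawU := by
    rw [← shiftedLaw_zero (M := M) j]
    exact hinteg j 0
  have heq : M.lawU = M.lawU.conv η := by
    refine hKinj _ _ inferInstance inferInstance hU ?_ ?_
    · rw [hconv]
      exact (hint1 j w).add_measure (hint1 j' w')
    · rw [hconv, integral_add_measure (hint1 j w) (hint1 j' w'), integral_smul_measure,
        integral_smul_measure, ENNReal.toReal_ofReal hwpos.le, ENNReal.toReal_ofReal hwpos'.le, h,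
        smul_add, smul_smul, smul_smul]
  have hzero := ae_eq_zero_of_conv_eq M.lawU η heq.symm
  -- Both weights are positive, so concentration of `η` at `0` passes to each component.
  rw [hη, ae_add_measure_iff, Measure.ae_ennreal_smul_measure_iff (by simpa using hwpos),
    Measure.ae_ennreal_smul_measure_iff (by simpa using hwpos')] at hzero
  refine fun hchange => hchange ⟨c, fun k => ?_⟩
  have hk : ∀ᵐ z ∂(ν k), z = 0 := by
    have hcases : k = j ∨ k = j' := by
      fin_cases j <;> fin_cases j' <;> fin_cases k <;> simp at hj ⊢
    rcases hcases with rfl | rfl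
    · exact hzero.1
    · exact hzero.2
  filter_upwards [ae_of_ae_map (continuous_fit _).measurable.aemeasurable hk] with ξ hξ
  rw [fit_sub, sub_eq_zero] at hξ
  exact hξ.symm

end Model

/-! ### Reduction to a candidate on one side of the true change point -/

lemma tendstoInMeasure_of_dist_le_max {Ω : Type*} [MeasurableSpace Ω] {P : Measure Ω}
    {f g : ℕ → Ω → ℝ} {l : ℝ} {a : ℕ → ℝ} (hf : TendstoInMeasure P f atTop fun _ => l)
    (ha : Tendsto a atTop (𝓝 0)) (h : ∀ T ω, dist (g T ω) l ≤ max (dist (f T ω) l) (a T)) :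
    TendstoInMeasure P g atTop fun _ => l := by
  rw [tendstoInMeasure_iff_dist] at hf ⊢
  intro r hr
  refine tendsto_of_tendsto_of_tendsto_of_le_of_le' tendsto_const_nhds (hf r hr)
    (Eventually.of_forall fun _ => zero_le) ?_
  filter_upwards [ha.eventually_lt_const hr] with T hT
  refine measure_mono fun ω hω => ?_
  have hω' : r ≤ dist (g T ω) l := hω
  rcases le_max_iff.1 (hω'.trans (h T ω)) with h1 | h1
  · exact h1
  · exact absurd h1 (not_le.2 hT)

lemma le_of_mem_admissible {ε : ℝ} (hε : 0 < ε) {T τ : ℕ} (h : τ ∈ admissible ε T) : τ ≤ T := by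
  have h1 : 0 ≤ ε * T := by positivity
  have h2 := h.2
  exact_mod_cast (by linarith : (τ : ℝ) ≤ T)

namespace Model

variable {Ω : Type*} {p q : ℕ} {M : Model Ω p q} {α ε : ℝ}
  {bhat : ℕ → ℕ → Ω → Fin 2 → Coef p q} {That : ℕ → Ω → ℕ}

lemma tendsto_T0_div (hlam0 : M.lam0 ∈ Set.Ioo (0 : ℝ) 1) :
    Tendsto (fun T : ℕ => (M.T0 T : ℝ) / T) atTop (𝓝 M.lam0) :=
  tendsto_floor_mul_div hlam0.1.le

lemma eventually_T0_mem_admissible (hlam0 : M.lam0 ∈ Set.Ioo (0 : ℝ) 1)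
    (hεlam0 : M.lam0 ∈ Set.Ioo ε (1 - ε)) : ∀ᶠ T in atTop, M.T0 T ∈ admissible ε T := by
  have h := tendsto_T0_div hlam0
  filter_upwards [h.eventually_const_lt hεlam0.1, h.eventually_lt_const hεlam0.2,
    eventually_gt_atTop 0] with T h1 h2 hT
  have hT' : (0 : ℝ) < T := by exact_mod_cast hT
  rw [lt_div_iff₀ hT'] at h1
  rw [div_lt_iff₀ hT'] at h2
  exact ⟨h1.le, by linarith⟩

variable [MeasurableSpace Ω] {P : Measure Ω} [IsProbabilityMeasure P]

lemma isChangePointSequence_T0 (hlam0 : M.lam0 ∈ Set.Ioo (0 : ℝ) 1)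
    (hεlam0 : M.lam0 ∈ Set.Ioo ε (1 - ε)) :
    IsChangePointSequence P ε (fun T _ => M.T0 T) where
  measurable _ := measurable_const
  admissible := (eventually_T0_mem_admissible hlam0 hεlam0).mono fun _ h _ => h
  fraction := ⟨M.lam0, tendstoInMeasure_of_tendsto_ae (fun _ => aestronglyMeasurable_const)
    (Eventually.of_forall fun _ => tendsto_T0_div hlam0)⟩

/-- The limit fraction of the minimizer cannot lie strictly inside regime `j`: here `τ` is the
minimizer, moved to the true change point where it falls into the other regime. -/
theorem not_structuralChange_of_minimizer (hα : α ∈ Set.Ioo (0 : ℝ) 2) (hq : q ≠ 0)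
    (hlam0 : M.lam0 ∈ Set.Ioo (0 : ℝ) 1) (hε : 0 < ε) (hεlam0 : M.lam0 ∈ Set.Ioo ε (1 - ε))
    (hx : M.RegressorAssumption P α) (hu : M.DisturbanceAssumption P α)
    (hest : M.EstimatorAssumption P ε bhat) (hY : M.AsymptoticIndependence P α)
    (hThat : M.IsEnergyMinimizer α ε bhat That) {l : ℝ} (hl : l ∈ Set.Ioo (0 : ℝ) 1)
    {j j' : Fin 2} (hj : j ≠ j') (hlt : segFraction l j < segFraction M.lam0 j)
    (hsubl : ∀ T : ℕ, segment T ⌊(T : ℝ) * l⌋₊ j ⊆ segment T (M.T0 T) j)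
    {τ : ℕ → Ω → ℕ} (hτmeas : ∀ T, Measurable (τ T))
    (hτeq : ∀ T ω, τ T ω = That T ω ∨ τ T ω = M.T0 T)
    (hsub : ∀ T ω, segment T (τ T ω) j ⊆ segment T (M.T0 T) j)
    (hτl : TendstoInMeasure P (fun T ω => (τ T ω : ℝ) / (T : ℝ)) atTop (fun _ => l))
    (hcons : IsChangePointSequence P ε τ →
      TendstoInMeasure P (fun T ω => bhat T (τ T ω) ω j) atTop (fun _ => M.beta0 j)) :
    ¬ M.StructuralChange := by
  have : NeZero q := ⟨hq⟩
  obtain ⟨K, hK0, hK, hKinj⟩ := exists_energy_embedding (E := Vec q) hα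
  have hT0adm := eventually_T0_mem_admissible hlam0 hεlam0
  have hτadm : ∀ᶠ T in atTop, ∀ ω, τ T ω ∈ admissible ε T := by
    filter_upwards [hT0adm, hThat] with T h1 h2 ω
    rcases hτeq T ω with h | h <;> rw [h]
    · exact (h2 ω).1
    · exact h1
  have hseq : IsChangePointSequence P ε τ := ⟨hτmeas, hτadm, l, hτl⟩
  obtain ⟨c, hc⟩ := hest.limit τ hseq j'
  have hseq0 := isChangePointSequence_T0 (P := P) hlam0 hεlam0
  have hb0 : ∀ k, TendstoInMeasure P (fun T ω => bhat T (M.T0 T) ω k) atTop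
      (fun _ => M.beta0 k) := by
    intro k
    fin_cases k
    · exact hest.consistent_left _ hseq0 (Eventually.of_forall fun T _ => le_rfl)
    · exact hest.consistent_right _ hseq0 (Eventually.of_forall fun T _ => le_rfl)
  have hobj : ∀ᶠ T : ℕ in atTop, ∀ ω,
      M.objective α bhat T ω (τ T ω) ≤ M.objective α bhat T ω (M.T0 T) := by
    filter_upwards [hT0adm, hThat] with T h1 h2 ω
    -- Where `τ` was moved to the true change point the comparison is an equality; elsewhere it is
    -- minimality.
    rcases hτeq T ω with h | h
    · rw [h]
      exact (h2 ω).2 h1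
    · rw [h]
  exact not_structuralChange_of_mixture hα.1 hK0 hK hKinj hx hu hlam0 hj hl hlt
    (embedding_eq_mixture hα.1 hK0 hK hx hu hY hlam0 hj hl hsubl
      (hτadm.mono fun T h ω => le_of_mem_admissible hε (h ω)) hsub hτl hobj (hcons hseq) hc hb0)

end Model

end ChangePoint

end

/-! ### The limit fraction of the estimated change point -/

theorem proposition1 {Ω : Type*} [MeasurableSpace Ω] (P : Measure Ω) [IsProbabilityMeasure P]
    {p q : ℕ} (M : ChangePoint.Model Ω p q)
    (α : ℝ) (hα : α ∈ Set.Ioo (0 : ℝ) 2)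
    -- the loss, the penalty and its weights
    (ψ : ChangePoint.Vec q → ℝ) (hψ : StrictConvexOn ℝ Set.univ ψ) (hψ0 : ∀ z, ψ 0 ≤ ψ z)
    (φ : (Fin 2 → ChangePoint.Coef p q) → ℝ) (hφ : ConvexOn ℝ Set.univ φ) (hφ0 : ∀ b, φ 0 ≤ φ b)
    (γ : ℕ → ℝ) (hγ : ∀ T, 0 ≤ γ T)
    -- the true change point fraction is interior, and it is interior to the range of the search
    (hlam0 : M.lam0 ∈ Set.Ioo (0 : ℝ) 1)
    (ε : ℝ) (hε : 0 < ε) (hεlam0 : M.lam0 ∈ Set.Ioo ε (1 - ε))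
    (hchange : M.StructuralChange)
    (hx : M.RegressorAssumption P α)
    (hu : M.DisturbanceAssumption P α)
    -- the regularized estimators
    (bhat : ℕ → ℕ → Ω → Fin 2 → ChangePoint.Coef p q)
    (hbhat : M.IsRegularizedEstimator ε ψ φ γ bhat)
    (hest : M.EstimatorAssumption P ε bhat)
    (hY : M.AsymptoticIndependence P α)
    -- the estimated change point
    (That : ℕ → Ω → ℕ) (hThat_meas : ∀ T, Measurable (That T))
    (hThat : M.IsEnergyMinimizer α ε bhat That)
    (lamhat : ℝ) (hlamhat : lamhat ∈ Set.Ioo (0 : ℝ) 1)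
    (hconv : TendstoInMeasure P (fun T ω => (That T ω : ℝ) / (T : ℝ)) atTop (fun _ => lamhat)) :
    lamhat = M.lam0 := by
  -- The embedding needs a nontrivial space; for `q = 0` all fitted values coincide and no change is
  -- possible.
  have hq : q ≠ 0 := by
    rintro rfl
    exact hchange ⟨M.beta0 0, fun j => Eventually.of_forall fun ξ => Subsingleton.elim _ _⟩
  have hT0 := ChangePoint.Model.tendsto_T0_div hlam0
  have hdist : Tendsto (fun T : ℕ => dist ((M.T0 T : ℝ) / T) M.lam0) atTop (𝓝 0) :=
    tendsto_iff_dist_tendsto_zero.1 hT0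
  rcases lt_trichotomy lamhat M.lam0 with hlt | heq | hgt
  -- Consistency on the left requires a candidate never beyond `M.T0 T`. Taking the minimum achieves
  -- this and, as `lamhat < M.lam0`, keeps the limit fraction.
  · refine absurd hchange (ChangePoint.Model.not_structuralChange_of_minimizer hα hq hlam0 hε hεlam0
      hx hu hest hY hThat hlamhat (j := 0) (j' := 1) (by decide)
      (by simpa [ChangePoint.segFraction] using hlt) (fun T t ht => ?_)
      (τ := fun T ω => min (That T ω) (M.T0 T)) (fun T => (hThat_meas T).min measurable_const)
      (fun T ω => min_choice _ _) (fun T ω t ht => ?_) ?_ fun hseq => ?_)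
    · rw [ChangePoint.mem_segment_zero] at ht ⊢
      refine ⟨ht.1, ht.2.trans (Nat.floor_le_floor ?_)⟩
      exact mul_le_mul_of_nonneg_left hlt.le (Nat.cast_nonneg _)
    · rw [ChangePoint.mem_segment_zero] at ht ⊢
      exact ⟨ht.1, ht.2.trans (min_le_right _ _)⟩
    · refine ChangePoint.tendstoInMeasure_of_dist_le_max hconv hdist fun T ω => ?_
      -- The minimum is 1-Lipschitz for the sup norm, and `min lamhat M.lam0 = lamhat`.
      have h := abs_min_sub_min_le_max ((That T ω : ℝ) / T) ((M.T0 T : ℝ) / T) lamhat M.lam0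
      rw [min_eq_left hlt.le, min_div_div_right (Nat.cast_nonneg T)] at h
      simpa only [Real.dist_eq, Nat.cast_min] using h
    · exact hest.consistent_left _ hseq (Eventually.of_forall fun T ω => min_le_right _ _)
  · exact heq
  · refine absurd hchange (ChangePoint.Model.not_structuralChange_of_minimizer hα hq hlam0 hε hεlam0
      hx hu hest hY hThat hlamhat (j := 1) (j' := 0) (by decide)
      (by simpa [ChangePoint.segFraction] using hgt) (fun T t ht => ?_)
      (τ := fun T ω => max (That T ω) (M.T0 T)) (fun T => (hThat_meas T).max measurable_const)
      (fun T ω => max_choice _ _) (fun T ω t ht => ?_) ?_ fun hseq => ?_)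
    · rw [ChangePoint.mem_segment_one] at ht ⊢
      refine ⟨le_trans (Nat.succ_le_succ (Nat.floor_le_floor ?_)) ht.1, ht.2⟩
      exact mul_le_mul_of_nonneg_left hgt.le (Nat.cast_nonneg _)
    · rw [ChangePoint.mem_segment_one] at ht ⊢
      exact ⟨le_trans (Nat.succ_le_succ (le_max_right _ _)) ht.1, ht.2⟩
    · refine ChangePoint.tendstoInMeasure_of_dist_le_max hconv hdist fun T ω => ?_
      have h := abs_max_sub_max_le_max ((That T ω : ℝ) / T) ((M.T0 T : ℝ) / T) lamhat M.lam0
      rw [max_eq_left hgt.le, max_div_div_right (Nat.cast_nonneg T)] at h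
      simpa only [Real.dist_eq, Nat.cast_max] using h
    · exact hest.consistent_right _ hseq (Eventually.of_forall fun T ω => le_max_right _ _)
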